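/- A digraph $\Gamma$ consists of a non-empty vertex set $V$ and an arc set $A\subseteq V\times V$ (loops allowed). It is regular if there is an integer $d\ge 0$ such that every vertex has exactly $d$ out-neighbours and exactly $d$ in-neighbours. Its automorphism group $\mathrm{Aut}(\Gamma)$ is the group of all permutations $\sigma$ of $V$ such that, for all $u,v\in V$, $(u^\sigma,v^\sigma)\in A$ if and only if $(u,v)\in A$. For a group $G$ and a positive integer $n$, an $n$-partite digraphical representation ($n$-PDR) of $G$ is a digraph $\Gamma$ such that * $\Gamma$ is regular; * $\mathrm{Aut}(\Gamma)\cong G$; * $\mathrm{Aut}(\Gamma)$ acts semiregularly on $V$, that is, all its point stabilisers are trivial; * $\mathrm{Aut}(\Gamma)$ has exactly $n$ orbits on $V$ and, for every orbit $X$, there is no arc of $\Gamma$ with both ends in $X$. **Theorem.** Let $G$ be a finite group and let $n$ be a positive integer. Then $G$ admits no $n$-partite digraphical representation if and only if one of the following holds: 1. $n=1$ and $|G|\ge 3$; 2. $n=2$ and $G$ is isomorphic to one of $\mathbb{Z}_1$, $\mathbb{Z}_2$, $\mathbb{Z}_3$, $\mathbb{Z}_2\times\mathbb{Z}_2$, $\mathbb{Z}_2\times\mathbb{Z}_2\times\mathbb{Z}_2$;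 3. $3\le n\le 5$ and $G\cong\mathbb{Z}_1$. Here $\mathbb{Z}_k$ denotes the cyclic group of order $k$. -/

import Mathlib

universe u v

namespace Digraph

/-- The automorphism group of a digraph, as a permutation group on its vertex set. -/
def autGroup {V : Type v} (Γ : Digraph V) : Subgroup (Equiv.Perm V) where
  carrier := {σ | ∀ x y : V, Γ.Adj (σ x) (σ y) ↔ Γ.Adj x y}
  one_mem' := fun _ _ => Iff.rfl
  mul_mem' := fun {σ τ} hσ hτ x y => (hσ (τ x) (τ y)).trans (hτ x y)
  inv_mem' := fun {σ} hσ x y => by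
    have h := hσ (σ⁻¹ x) (σ⁻¹ y)
    simpa using h.symm

/-- A digraph is regular if, for some natural number `d`, every vertex has exactly `d`
out-neighbours and exactly `d` in-neighbours. -/
def IsRegular {V : Type v} (Γ : Digraph V) : Prop :=
  ∃ d : ℕ, ∀ x : V, {y : V | Γ.Adj x y}.encard = d ∧ {y : V | Γ.Adj y x}.encard = d

end Digraph

/-- A permutation group is semiregular if all its point stabilisers are trivial. -/
def Equiv.Perm.IsSemiregularSubgroup {V : Type v} (A : Subgroup (Equiv.Perm V)) : Prop :=
  ∀ x : V, MulAction.stabilizer A x = ⊥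

/-- `Γ` is an `n`-partite digraphical representation of the group `G`. -/
structure Digraph.IsPartiteRepresentation {V : Type v} (Γ : Digraph V)
    (G : Type u) [Group G] (n : ℕ) : Prop where
  regular : Γ.IsRegular
  aut_iso : Nonempty (Γ.autGroup ≃* G)
  semiregular : Equiv.Perm.IsSemiregularSubgroup Γ.autGroup
  card_orbits : ENat.card (MulAction.orbitRel.Quotient Γ.autGroup V) = n
  /-- the sub-digraph induced on each orbit has no arcs (in particular, no loops) -/
  orbit_empty : ∀ z : V, ∀ x ∈ MulAction.orbit Γ.autGroup z,
    ∀ y ∈ MulAction.orbit Γ.autGroup z, ¬ Γ.Adj x y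

/-- `G` admits an `n`-partite digraphical representation; the vertex set is a non-empty type
in an arbitrary universe `v`. -/
def AdmitsPartiteRepresentation (G : Type u) [Group G] (n : ℕ) : Prop :=
  ∃ (V : Type v) (_ : Nonempty V) (Γ : Digraph V), Γ.IsPartiteRepresentation G n

/-! For existence it suffices to build a regular digraph on `G × I`, with `I` of size n and no arcs
inside the fibres, whose only automorphisms are the left translations. The constructions start from
a generating sequence x_0, …, x_{m-1} of length the rank; its irredundancy excludes unwanted
coincidences between short words. The quotients x_{i+1}⁻¹ x_i (`steps`) join the generators into a
path. So an injective map that permutes the generators, fixes x_0 and preserves such a set of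
differences fixes every generator (`fixes_of_path`), and then normalised automorphisms are trivial
(`eq_mul_of_fixes_generators`).

In both constructions bidirected edges tie the levels together, so that an automorphism comes from
one map τ of `G`. For n ≥ 3 the levels form a cycle, and the bidirected edges form one path per
element of `G`, oriented by a single one-way arc; the connection sets then single out x_0 and the
path (`admits_of_three_le`). For n = 2 the bidirected edges form a perfect matching, and an exchange
of the two levels must be excluded as well. This is done separately for cyclic groups of order at
least 4, for rank at least 2 with some element not squaring to 1, and for exponent two with rank at
least 4. Exactly the five listed groups remain.

For the trivial group the question is whether an asymmetric loopless regular digraph on n vertices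
exists. There are examples for n ≥ 6. For 2 ≤ n ≤ 5 complementation leaves valency at most 1, or
valency 2 on five vertices, which is settled by exhaustion. For n = 1 the digraph has no arcs, so
transpositions destroy semiregularity once |G| ≥ 3. For n = 2 and a nontrivial exceptional group,
every pair of connection sets of equal size is preserved or interchanged by an affine map of the
abelian group `G`, which yields an automorphism that is not a translation
(`HasAffineSymmetries.not_admits_two`). -/

/-! ### Digraphs on `G × I` whose automorphisms are translations -/

/-- Regularity is preserved by relabelling vertices. -/
theorem Digraph.IsRegular.comap {V W : Type*} {Γ : Digraph V} (h : Γ.IsRegular) (e : W ≃ V) :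
    (Digraph.mk fun x y : W => Γ.Adj (e x) (e y)).IsRegular := by
  obtain ⟨d, hd⟩ := h
  refine ⟨d, fun x => ⟨?_, ?_⟩⟩
  · rw [← (hd (e x)).1, ← Set.encard_preimage_of_bijective e.bijective]
    rfl
  · rw [← (hd (e x)).2, ← Set.encard_preimage_of_bijective e.bijective]
    rfl

/-- The translation by `t` of `G × I`, transported along `e : V ≃ G × I`. -/
def translationHom {V I G : Type*} [Group G] (e : V ≃ G × I) : G →* Equiv.Perm V where
  toFun t := (e.trans ((Equiv.mulLeft t).prodCongr (Equiv.refl I))).trans e.symm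
  map_one' := by ext x; simp
  map_mul' a b := by ext x; simp [Prod.map]

theorem translationHom_apply {V I G : Type*} [Group G] (e : V ≃ G × I) (t : G) (x : V) :
    translationHom e t x = e.symm (t * (e x).1, (e x).2) := rfl

/-- A regular digraph on `G × I` with no arcs inside the fibres over `I`, whose automorphisms are
exactly the left translations, gives a partite representation of `G`. -/
theorem admits_of_translations {G : Type u} [Group G] [Finite G] {I : Type} [Finite I] [Nonempty I]
    (Γ : Digraph (G × I)) (hreg : Γ.IsRegular)
    (htrans : ∀ t x y, Γ.Adj (t * x.1, x.2) (t * y.1, y.2) ↔ Γ.Adj x y)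
    (hrigid : ∀ σ ∈ Γ.autGroup, ∃ t, ∀ x, σ x = (t * x.1, x.2))
    (hpart : ∀ x y, x.2 = y.2 → ¬ Γ.Adj x y) :
    AdmitsPartiteRepresentation.{u, v} G (Nat.card I) := by
  classical
  obtain ⟨N, ⟨e₀⟩⟩ := Finite.exists_equiv_fin (G × I)
  -- `G × I` lives in the universe of `G`; a lifted `Fin N` provides a vertex set in the arbitrary
  -- universe `v`.
  let V := ULift.{v} (Fin N)
  let e : V ≃ G × I := Equiv.ulift.trans e₀.symm
  have hV : Nonempty V := e.nonempty
  let Δ : Digraph V := ⟨fun x y => Γ.Adj (e x) (e y)⟩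
  have hrange : (translationHom e).range = Δ.autGroup := by
    ext σ
    constructor
    · rintro ⟨t, rfl⟩ x y
      simp only [Δ, translationHom_apply, Equiv.apply_symm_apply]
      exact htrans t _ _
    · intro hσ
      obtain ⟨t, ht⟩ := hrigid ((e.symm.trans σ).trans e) (fun x y => by
        simpa [Δ] using hσ (e.symm x) (e.symm y))
      refine ⟨t, Equiv.ext fun x => ?_⟩
      have := ht (e x)
      simp only [Equiv.trans_apply, Equiv.symm_apply_apply] at this
      rw [translationHom_apply, ← this, Equiv.symm_apply_apply]
  have hinj : Function.Injective (translationHom e) := by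
    intro s t hst
    obtain ⟨i⟩ := ‹Nonempty I›
    have := congrArg e (DFunLike.congr_fun hst (e.symm (1, i)))
    simpa [translationHom_apply] using this
  have hmem : ∀ t, translationHom e t ∈ Δ.autGroup := fun t => hrange ▸ ⟨t, rfl⟩
  have horbit : ∀ x y : V, x ∈ MulAction.orbit Δ.autGroup y ↔ (e x).2 = (e y).2 := by
    intro x y
    constructor
    · rintro ⟨⟨σ, hσ⟩, rfl⟩
      rw [← hrange] at hσ
      obtain ⟨t, rfl⟩ := hσ
      change (e (translationHom e t y)).2 = _
      simp [translationHom_apply]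
    · intro h
      refine ⟨⟨translationHom e ((e x).1 * (e y).1⁻¹), hmem _⟩, ?_⟩
      change translationHom e _ y = x
      rw [translationHom_apply, inv_mul_cancel_right, ← h]
      simp
  refine ⟨V, hV, Δ, hreg.comap e, ⟨?_⟩, ?_, ?_, ?_⟩
  · exact (MulEquiv.subgroupCongr hrange.symm).trans (MonoidHom.ofInjective hinj).symm
  · intro x
    rw [eq_bot_iff]
    rintro ⟨σ, hσ⟩ hx
    rw [← hrange] at hσ
    obtain ⟨t, rfl⟩ := hσ
    have hx' : translationHom e t x = x := hx
    have : (e (translationHom e t x)).1 = (e x).1 := by rw [hx']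
    rw [translationHom_apply, Equiv.apply_symm_apply] at this
    have ht : t = 1 := by simpa using this
    subst ht
    simp
  · let f : MulAction.orbitRel.Quotient Δ.autGroup V → I :=
      Quotient.lift (fun x => (e x).2) (fun x y h => (horbit x y).1 h)
    have hf : Function.Bijective f := by
      constructor
      · rintro ⟨x⟩ ⟨y⟩ h
        exact Quotient.sound ((horbit x y).2 h)
      · intro i
        exact ⟨Quotient.mk _ (e.symm (1, i)), by simp [f]⟩
    rw [ENat.card_congr (Equiv.ofBijective f hf), ENat.card_eq_coe_natCard]
  · intro z x hx y hy
    exact hpart _ _ (((horbit x z).1 hx).trans ((horbit y z).1 hy).symm)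

theorem encard_out {G I : Type*} [Group G] (g : G) (j : I) (T : Set G) :
    {y : G × I | y.2 = j ∧ g⁻¹ * y.1 ∈ T}.encard = T.encard := by
  have : {y : G × I | y.2 = j ∧ g⁻¹ * y.1 ∈ T} = (fun c => (g * c, j)) '' T := by
    ext ⟨h, k⟩
    simp only [Set.mem_ofPred_eq, Set.mem_image, Prod.mk.injEq]
    constructor
    · rintro ⟨rfl, hT⟩
      exact ⟨_, hT, by simp, rfl⟩
    · rintro ⟨c, hc, rfl, rfl⟩
      simpa using hc
  rw [this, Function.Injective.encard_image]
  intro a b h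
  simpa using h

theorem encard_in {G I : Type*} [Group G] (g : G) (j : I) (T : Set G) :
    {y : G × I | y.2 = j ∧ y.1⁻¹ * g ∈ T}.encard = T.encard := by
  have : {y : G × I | y.2 = j ∧ y.1⁻¹ * g ∈ T} = (fun c => (g * c⁻¹, j)) '' T := by
    ext ⟨h, k⟩
    simp only [Set.mem_ofPred_eq, Set.mem_image, Prod.mk.injEq]
    constructor
    · rintro ⟨rfl, hT⟩
      exact ⟨_, hT, by simp, rfl⟩
    · rintro ⟨c, hc, rfl, rfl⟩
      simpa using hc
  rw [this, Function.Injective.encard_image]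
  intro a b h
  simpa using h

/-- If a class of maps `G → G` is stable under left translations and its members fixing `1` fix a
generating set pointwise, then its members are left translations. -/
theorem eq_mul_of_fixes_generators {G : Type*} [Group G] {R : Set G}
    (hR : Subgroup.closure R = ⊤) {P : (G → G) → Prop}
    (htrans : ∀ τ, P τ → ∀ s t : G, P fun g => s * τ (t * g))
    (hfix : ∀ τ, P τ → τ 1 = 1 → ∀ r ∈ R, τ r = r) {τ : G → G} (hτ : P τ) (g : G) :
    τ g = τ 1 * g := by
  -- The normalised map g ↦ (τ h)⁻¹ τ(h g) belongs to the class and fixes 1, so it fixes `r`.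
  have key : ∀ h, ∀ r ∈ R, τ (h * r) = τ h * r := by
    intro h r hr
    have := hfix _ (htrans τ hτ (τ h)⁻¹ h) (by simp) r hr
    rwa [inv_mul_eq_iff_eq_mul] at this
  have hall : ∀ c ∈ Subgroup.closure R, ∀ h, τ (h * c) = τ h * c := by
    intro c hc
    induction hc using Subgroup.closure_induction with
    | mem r hr => exact fun h => key h r hr
    | one => simp
    | mul a b _ _ iha ihb =>
      intro h
      rw [← mul_assoc, ihb, iha, mul_assoc]
    | inv a _ iha =>
      intro h
      have := iha (h * a⁻¹)
      rw [inv_mul_cancel_right] at this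
      rw [this, mul_inv_cancel_right]
  simpa using hall g (hR ▸ Subgroup.mem_top g) 1

/-! ### Irredundant generating sequences -/

/-- `x 0, …, x (m - 1)` are irredundant generators: none lies in the subgroup generated by the
others. -/
structure IrredundantGenerators {G : Type*} [Group G] (x : ℕ → G) (m : ℕ) : Prop where
  closure_eq : Subgroup.closure (x '' Set.Iio m) = ⊤
  notMem : ∀ k < m, x k ∉ Subgroup.closure (x '' (Set.Iio m \ {k}))

/-- The subgroup generated by all `x i`, `i < m`, except `x k`. -/
def othersClosure {G : Type*} [Group G] (x : ℕ → G) (m k : ℕ) : Subgroup G :=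
  Subgroup.closure (x '' (Set.Iio m \ {k}))

theorem mem_othersClosure {G : Type*} [Group G] (x : ℕ → G) {m i k : ℕ} (hi : i < m)
    (h : i ≠ k) : x i ∈ othersClosure x m k :=
  Subgroup.subset_closure ⟨i, ⟨hi, h⟩, rfl⟩

/-- A finite group has an irredundant generating sequence of length its rank; if some element is
not an involution, the first term can be chosen not to be an involution. -/
theorem exists_irredundantGenerators (G : Type*) [Group G] [Finite G] :
    ∃ x : ℕ → G, IrredundantGenerators x (Group.rank G) ∧
      ((∃ g : G, g ^ 2 ≠ 1) → x 0 ^ 2 ≠ 1) := by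
  classical
  -- any generating finset of minimal size can be enumerated, starting anywhere
  have enum : ∀ S : Finset G, S.card = Group.rank G → Subgroup.closure (S : Set G) = ⊤ →
      ∀ s, (S.Nonempty → s ∈ S) → ∃ x : ℕ → G, IrredundantGenerators x (Group.rank G) ∧
        (S.Nonempty → x 0 = s) := by
    intro S hS hcl s hs
    obtain ⟨x, hx0, hxS⟩ : ∃ x : ℕ → G, (S.Nonempty → x 0 = s) ∧
        x '' Set.Iio (Group.rank G) = S := by
      by_cases hne : S.Nonempty
      · have hs := hs hne
        have hpos : 0 < S.card := hne.card_pos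
        let e := S.equivFin
        let e' := e.trans (Equiv.swap (e ⟨s, hs⟩) ⟨0, hpos⟩)
        refine ⟨fun i => if h : i < S.card then (e'.symm ⟨i, h⟩ : G) else 1, fun _ => ?_, ?_⟩
        · simp [hpos, e']
        · ext g
          constructor
          · rintro ⟨i, hi, rfl⟩
            rw [Set.mem_Iio, ← hS] at hi
            simp [hi]
          · intro hg
            refine ⟨e' ⟨g, hg⟩, ?_, ?_⟩
            · rw [Set.mem_Iio, ← hS]
              exact (e' ⟨g, hg⟩).2
            · simp
      · rw [Finset.not_nonempty_iff_eq_empty] at hne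
        subst hne
        exact ⟨fun _ => 1, by simp, by simp [← hS]⟩
    refine ⟨x, ⟨by rw [hxS, hcl], ?_⟩, hx0⟩
    intro k hk hmem
    -- A redundant `x k` could be dropped, leaving a generating set smaller than the rank.
    have hgen : Subgroup.closure
        ((((Finset.range (Group.rank G)).erase k).image x : Finset G) : Set G) = ⊤ := by
      rw [eq_top_iff, ← hcl, ← hxS, Subgroup.closure_le]
      have hset : ((((Finset.range (Group.rank G)).erase k).image x : Finset G) : Set G) =
          x '' (Set.Iio (Group.rank G) \ {k}) := by
        simp [Set.sdiff_eq, Finset.coe_image]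
      rw [hset]
      rintro _ ⟨i, hi, rfl⟩
      by_cases hik : i = k
      · rw [hik]; exact hmem
      · exact Subgroup.subset_closure ⟨i, ⟨hi, hik⟩, rfl⟩
    have h1 := Group.rank_le hgen
    have h2 : (((Finset.range (Group.rank G)).erase k).image x).card ≤ _ := Finset.card_image_le
    rw [Finset.card_erase_of_mem (Finset.mem_range.2 hk), Finset.card_range] at h2
    omega
  obtain ⟨S, hS, hcl⟩ := Group.rank_spec G
  by_cases hex : ∃ g : G, g ^ 2 ≠ 1
  · obtain ⟨S', hS', hcl', s, hs, hs2⟩ : ∃ S' : Finset G, S'.card = Group.rank G ∧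
        Subgroup.closure (S' : Set G) = ⊤ ∧ ∃ s ∈ S', s ^ 2 ≠ 1 := by
      by_cases hall : ∃ s ∈ S, s ^ 2 ≠ 1
      · exact ⟨S, hS, hcl, hall⟩
      push Not at hall
      by_cases hprod : ∃ a ∈ S, ∃ b ∈ S, (a * b) ^ 2 ≠ 1
      · obtain ⟨a, ha, b, hb, hab⟩ := hprod
        have hne : a ≠ b := by
          rintro rfl
          have := hall a ha
          rw [pow_two] at this
          simp [this] at hab
        -- Replacing `a` by `a * b` keeps the set generating, because `b` remains, and does not
        -- enlarge it.
        set S' := insert (a * b) (S.erase a) with hS'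
        have hcl' : Subgroup.closure (S' : Set G) = ⊤ := by
          rw [eq_top_iff, ← hcl, Subgroup.closure_le]
          have hb' : b ∈ Subgroup.closure (S' : Set G) :=
            Subgroup.subset_closure (by simp [hS', hb, hne.symm])
          have hab' : a * b ∈ Subgroup.closure (S' : Set G) :=
            Subgroup.subset_closure (by simp [hS'])
          intro s hs
          by_cases hsa : s = a
          · rw [hsa]
            have := mul_mem hab' (inv_mem hb')
            rwa [mul_inv_cancel_right] at this
          · refine Subgroup.subset_closure ?_
            have : s ∈ S := hs
            simp [hS', hsa, this]
        refine ⟨S', le_antisymm ?_ (Group.rank_le hcl'), hcl', a * b, by simp [hS'], hab⟩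
        refine (Finset.card_insert_le _ _).trans ?_
        rw [Finset.card_erase_of_mem ha, hS]
        have : 0 < S.card := Finset.card_pos.2 ⟨a, ha⟩
        omega
      · push Not at hprod
        exfalso
        obtain ⟨g, hg⟩ := hex
        -- If the generators and their pairwise products all square to 1, then the generators
        -- commute, so the whole group has exponent dividing two.
        have hcomm : ∀ a ∈ (S : Set G), ∀ b ∈ (S : Set G), a * b = b * a := by
          intro a ha b hb
          have h1 := hall a ha
          have h2 := hall b hb
          have h3 := hprod a ha b hb
          rw [pow_two] at h1 h2 h3
          rw [mul_eq_one_iff_eq_inv, mul_inv_rev, ← mul_eq_one_iff_eq_inv.1 h1,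
            ← mul_eq_one_iff_eq_inv.1 h2] at h3
          exact h3
        have hcommG : ∀ g h : G, g * h = h * g := by
          have hc := Subgroup.isMulCommutative_closure hcomm
          intro g h
          have hg : g ∈ Subgroup.closure (S : Set G) := hcl ▸ Subgroup.mem_top g
          have hh : h ∈ Subgroup.closure (S : Set G) := hcl ▸ Subgroup.mem_top h
          exact congrArg Subtype.val (hc.is_comm.comm ⟨g, hg⟩ ⟨h, hh⟩)
        have hexp : ∀ g ∈ Subgroup.closure (S : Set G), g ^ 2 = 1 := by
          intro g hg
          induction hg using Subgroup.closure_induction with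
          | mem s hs => exact hall s hs
          | one => simp
          | mul a b _ _ ha hb =>
            rw [(show Commute a b from hcommG a b).mul_pow, ha, hb, one_mul]
          | inv a _ ha => rw [inv_pow, ha, inv_one]
        exact hg (hexp g (hcl ▸ Subgroup.mem_top g))
    obtain ⟨x, hx, hx0⟩ := enum S' hS' hcl' s fun _ => hs
    exact ⟨x, hx, fun _ => by rwa [hx0 ⟨s, hs⟩]⟩
  · by_cases hne : S.Nonempty
    · obtain ⟨s, hs⟩ := hne
      obtain ⟨x, hx, -⟩ := enum S hS hcl s fun _ => hs
      exact ⟨x, hx, fun h => absurd h hex⟩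
    · obtain ⟨x, hx, -⟩ := enum S hS hcl 1 fun h => absurd h hne
      exact ⟨x, hx, fun h => absurd h hex⟩

namespace IrredundantGenerators

theorem ne_one {G : Type*} [Group G] {x : ℕ → G} {m : ℕ} (hx : IrredundantGenerators x m)
    {i : ℕ} (hi : i < m) : x i ≠ 1 := fun h =>
  hx.notMem i hi (h ▸ one_mem _)

theorem injOn {G : Type*} [Group G] {x : ℕ → G} {m : ℕ} (hx : IrredundantGenerators x m)
    {i j : ℕ} (hi : i < m) (hj : j < m) (h : x i = x j) : i = j := by
  by_contra hne
  exact hx.notMem i hi (h ▸ mem_othersClosure x hj (Ne.symm hne))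

theorem not_left {G : Type*} [Group G] {x : ℕ → G} {m : ℕ} (hx : IrredundantGenerators x m)
    {k : ℕ} (hk : k < m) {h : G} (hh : h ∈ othersClosure x m k) :
    (x k)⁻¹ * h ∉ othersClosure x m k := by
  rw [Subgroup.mul_mem_cancel_right _ hh, inv_mem_iff]
  exact hx.notMem k hk

theorem not_right {G : Type*} [Group G] {x : ℕ → G} {m : ℕ} (hx : IrredundantGenerators x m)
    {k : ℕ} (hk : k < m) {h : G} (hh : h ∈ othersClosure x m k) :
    h * x k ∉ othersClosure x m k := by
  rw [Subgroup.mul_mem_cancel_left _ hh]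
  exact hx.notMem k hk

/-- An equality would put one generator in the subgroup generated by the others: `x b` if c = a, and
`x a` if c differs from a. The next two lemmas rest on the same principle: an index occurring once
in a relation can be solved for. -/
theorem quotient_ne_single {G : Type*} [Group G] {x : ℕ → G} {m : ℕ}
    (hx : IrredundantGenerators x m) {a b c : ℕ} (ha : a < m) (hb : b < m) (hc : c < m) :
    (x a)⁻¹ * x b ≠ x c := by
  intro h
  have mem := fun {i k : ℕ} (hi : i < m) (hik : i ≠ k) => mem_othersClosure x hi hik
  by_cases hab : a = b
  · subst hab
    rw [inv_mul_cancel] at h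
    exact hx.ne_one hc h.symm
  by_cases hca : c = a
  · subst hca
    have := hx.not_right hb (inv_mem (mem ha hab))
    exact this (h.symm ▸ mem ha hab)
  · exact hx.not_left ha (mem hb (Ne.symm hab)) (h ▸ mem hc hca)

theorem quotient_eq_quotient {G : Type*} [Group G] {x : ℕ → G} {m : ℕ}
    (hx : IrredundantGenerators x m) {a b c d : ℕ} (ha : a < m) (hb : b < m) (hc : c < m)
    (hd : d < m) (hab : a ≠ b) (h : (x a)⁻¹ * x b = (x c)⁻¹ * x d) :
    (a = c ∧ b = d) ∨ (a = d ∧ b = c) := by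
  have mem := fun {i k : ℕ} (hi : i < m) (hik : i ≠ k) => mem_othersClosure x hi hik
  have h1 : a = c ∨ a = d := by
    by_contra! hne
    exact hx.not_left ha (mem hb hab.symm)
      (h ▸ mul_mem (inv_mem (mem hc hne.1.symm)) (mem hd hne.2.symm))
  have h2 : b = c ∨ b = d := by
    by_contra! hne
    exact hx.not_right hb (inv_mem (mem ha hab))
      (h ▸ mul_mem (inv_mem (mem hc hne.1.symm)) (mem hd hne.2.symm))
  omega

theorem mul_eq_quotient {G : Type*} [Group G] {x : ℕ → G} {m : ℕ}
    (hx : IrredundantGenerators x m) {a b c d : ℕ} (ha : a < m) (hb : b < m) (hc : c < m)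
    (hd : d < m) (hab : a ≠ b) (h : (x a)⁻¹ * x b = x c * x d) :
    (a = c ∧ b = d) ∨ (a = d ∧ b = c) := by
  have mem := fun {i k : ℕ} (hi : i < m) (hik : i ≠ k) => mem_othersClosure x hi hik
  have h1 : a = c ∨ a = d := by
    by_contra! hne
    exact hx.not_left ha (mem hb hab.symm)
      (h ▸ mul_mem (mem hc hne.1.symm) (mem hd hne.2.symm))
  have h2 : b = c ∨ b = d := by
    by_contra! hne
    exact hx.not_right hb (inv_mem (mem ha hab))
      (h ▸ mul_mem (mem hc hne.1.symm) (mem hd hne.2.symm))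
  omega

theorem single_ne_inv {G : Type*} [Group G] {x : ℕ → G} {m : ℕ}
    (hx : IrredundantGenerators x m) {a b : ℕ} (ha : a < m) (hb : b < m) (hab : a ≠ b) :
    x a ≠ (x b)⁻¹ := fun h =>
  hx.notMem a ha (h ▸ inv_mem (mem_othersClosure x hb hab.symm))

/-- In an elementary abelian `2`-group, a word in irredundant generators is trivial only if every
generator occurs an even number of times. -/
theorem even_count {G : Type*} [CommGroup G] {x : ℕ → G} {m : ℕ}
    (hx : IrredundantGenerators x m) (hexp : ∀ g : G, g ^ 2 = 1) {l : List ℕ}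
    (hl : ∀ i ∈ l, i < m) (h : (l.map x).prod = 1) (k : ℕ) : Even (l.count k) := by
  by_cases hk : k < m
  · have key : ∀ l : List ℕ, (∀ i ∈ l, i < m) →
        ∃ c ∈ othersClosure x m k, (l.map x).prod = x k ^ l.count k * c := by
      intro l
      induction l with
      | nil => exact fun _ => ⟨1, one_mem _, by simp⟩
      | cons i l ih =>
        intro hl
        obtain ⟨c, hc, h⟩ := ih fun j hj => hl j (List.mem_cons_of_mem _ hj)
        by_cases hik : i = k
        · subst hik
          exact ⟨c, hc, by simp [h, pow_succ']; group⟩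
        · refine ⟨x i * c, mul_mem (mem_othersClosure x (hl i List.mem_cons_self) hik) hc, ?_⟩
          simp [h, hik, mul_left_comm]
    obtain ⟨c, hc, hprod⟩ := key l hl
    by_contra hodd
    rw [Nat.not_even_iff_odd] at hodd
    obtain ⟨t, ht⟩ := hodd
    rw [h, ht, pow_succ, pow_mul, hexp, one_pow, one_mul] at hprod
    exact hx.notMem k hk ((Subgroup.mul_mem_cancel_right _ hc).1 (hprod ▸ one_mem _))
  · rw [List.count_eq_zero_of_not_mem fun hmem => hk (hl k hmem)]
    exact Even.zero

/-- Length parity separates the generators, words of length one, from the steps, words of length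
two. -/
theorem even_length {G : Type*} [CommGroup G] {x : ℕ → G} {m : ℕ}
    (hx : IrredundantGenerators x m) (hexp : ∀ g : G, g ^ 2 = 1) {l : List ℕ}
    (hl : ∀ i ∈ l, i < m) (h : (l.map x).prod = 1) : Even l.length := by
  rw [← List.sum_toFinset_count_eq_length]
  exact Finset.even_sum _ fun k _ => hx.even_count hexp hl h k

end IrredundantGenerators

/-! ### The path formed by the generators -/

/-- The quotients of consecutive generators. -/
def steps {G : Type*} [Group G] (x : ℕ → G) (m : ℕ) : Set G :=
  (fun i => (x (i + 1))⁻¹ * x i) '' Set.Iio (m - 1)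

theorem mem_steps {G : Type*} [Group G] {x : ℕ → G} {m : ℕ} {g : G} :
    g ∈ steps x m ↔ ∃ i, i + 1 < m ∧ (x (i + 1))⁻¹ * x i = g := by
  simp only [steps, Set.mem_image, Set.mem_Iio]
  exact exists_congr fun i => and_congr_left fun _ => by omega

namespace IrredundantGenerators

theorem encard_gens {G : Type*} [Group G] {x : ℕ → G} {m : ℕ}
    (hx : IrredundantGenerators x m) : (x '' Set.Iio m).encard = m := by
  have hinj : Set.InjOn x (Set.Iio m) := fun i hi j hj h => hx.injOn hi hj h
  rw [hinj.encard_image]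
  simp [Set.encard_eq_coe_toFinset_card]

theorem encard_steps {G : Type*} [Group G] {x : ℕ → G} {m : ℕ}
    (hx : IrredundantGenerators x m) : (steps x m).encard = (m - 1 : ℕ) := by
  rw [steps, Set.InjOn.encard_image]
  · simp [Set.encard_eq_coe_toFinset_card]
  · intro i hi j hj h
    rw [Set.mem_Iio] at hi hj
    have := hx.quotient_eq_quotient (by omega) (by omega) (by omega) (by omega) (by omega) h
    omega

theorem one_notMem_steps {G : Type*} [Group G] {x : ℕ → G} {m : ℕ}
    (hx : IrredundantGenerators x m) : (1 : G) ∉ steps x m := by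
  rw [mem_steps]
  rintro ⟨i, hi, h⟩
  have := hx.injOn (by omega) (by omega) (inv_mul_eq_one.1 h)
  omega

theorem gen_notMem_steps {G : Type*} [Group G] {x : ℕ → G} {m : ℕ}
    (hx : IrredundantGenerators x m) {i : ℕ} (hi : i < m) : x i ∉ steps x m := by
  rw [mem_steps]
  rintro ⟨j, hj, h⟩
  exact hx.quotient_ne_single (by omega) (by omega) hi h

theorem quotient_mem_steps {G : Type*} [Group G] {x : ℕ → G} {m : ℕ}
    (hx : IrredundantGenerators x m) {a b : ℕ} (ha : a < m) (hb : b < m)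
    (h : (x a)⁻¹ * x b ∈ steps x m) : a = b + 1 ∨ b = a + 1 := by
  rw [mem_steps] at h
  obtain ⟨i, hi, h⟩ := h
  have := hx.quotient_eq_quotient (by omega) (by omega) ha hb (by omega) h
  omega

/-- A map permuting irredundant generators, fixing the first one and preserving a set of
differences whose arcs among the generators form a path, fixes all generators. -/
theorem fixes_of_path {G : Type*} [Group G] {x : ℕ → G} {m : ℕ}
    (hx : IrredundantGenerators x m) {Q : Set G} (hQ : steps x m ⊆ Q)
    (hpath : ∀ a < m, ∀ b < m, (x a)⁻¹ * x b ∈ Q → a = b ∨ a = b + 1 ∨ b = a + 1)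
    {τ : G → G} (hinj : Function.Injective τ)
    (hmaps : ∀ i < m, ∃ j < m, τ (x i) = x j) (h0 : τ (x 0) = x 0)
    (harc : ∀ g h : G, g⁻¹ * h ∈ Q → (τ g)⁻¹ * τ h ∈ Q) :
    ∀ i < m, τ (x i) = x i := by
  intro i
  induction i using Nat.strong_induction_on with
  | _ i ih =>
    intro hi
    cases i with
    | zero => exact h0
    | succ k =>
      have hk := ih k (by omega) (by omega)
      obtain ⟨j, hj, hτ⟩ := hmaps (k + 1) hi
      have h1 := harc (x (k + 1)) (x k) (hQ (mem_steps.2 ⟨k, hi, rfl⟩))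
      rw [hτ, hk] at h1
      have h2 := hpath j hj k (by omega) h1
      by_cases hjk : j = k + 1
      · rw [hτ, hjk]
      -- The image is adjacent or equal to `x k` on the path, so j ≤ k here. Then `x j` is already
      -- its own image, against injectivity.
      · have h3 : τ (x j) = x j := ih j (by omega) hj
        have h4 := hx.injOn hj hi (hinj (h3.trans hτ.symm))
        omega

end IrredundantGenerators

/-! ### Three or more parts -/

/-- The digraph on `G × Fin n` with forward arcs `(g, i) → (g * c, i + 1)`, `c ∈ T i`, and
backward arcs `(g, i + 1) → (g, i)`. -/
def cyclicDigraph {G : Type*} [Group G] {n : ℕ} [NeZero n] (T : Fin n → Set G) :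
    Digraph (G × Fin n) :=
  ⟨fun x y => (y.2 = x.2 + 1 ∧ x.1⁻¹ * y.1 ∈ T x.2) ∨ (x.2 = y.2 + 1 ∧ x.1 = y.1)⟩

/-- Two vertices joined by arcs in both directions. -/
def Digraph.Bidirected {V : Type*} (Γ : Digraph V) (x y : V) : Prop := Γ.Adj x y ∧ Γ.Adj y x

theorem Digraph.bidirected_map {V : Type*} {Γ : Digraph V} {σ : Equiv.Perm V}
    (hσ : σ ∈ Γ.autGroup) (x y : V) : Γ.Bidirected (σ x) (σ y) ↔ Γ.Bidirected x y :=
  and_congr (hσ x y) (hσ y x)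

/-- A vertex on exactly one bidirected edge. -/
def Digraph.IsEnd {V : Type*} (Γ : Digraph V) (x : V) : Prop := ∃! y, Γ.Bidirected x y

theorem Digraph.isEnd_map {V : Type*} {Γ : Digraph V} {σ : Equiv.Perm V}
    (hσ : σ ∈ Γ.autGroup) (x : V) : Γ.IsEnd (σ x) ↔ Γ.IsEnd x :=
  (σ.existsUnique_congr fun {y} => (Digraph.bidirected_map hσ x y).symm).symm

/-- An end of a bidirected path with an arc to an end in the same bidirected component. -/
def Digraph.IsStart {V : Type*} (Γ : Digraph V) (x : V) : Prop :=
  Γ.IsEnd x ∧ ∃ y, Γ.IsEnd y ∧ Γ.Adj x y ∧ Relation.ReflTransGen Γ.Bidirected x y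

theorem Digraph.isStart_of_mem {V : Type*} {Γ : Digraph V} {σ : Equiv.Perm V}
    (hσ : σ ∈ Γ.autGroup) {x : V} (hx : Γ.IsStart x) : Γ.IsStart (σ x) := by
  obtain ⟨h1, y, h2, h3, h4⟩ := hx
  refine ⟨(Digraph.isEnd_map hσ x).2 h1, σ y, (Digraph.isEnd_map hσ y).2 h2, (hσ x y).2 h3, ?_⟩
  exact h4.lift σ fun a b h => (Digraph.bidirected_map hσ a b).2 h

theorem Fin.eq_add_one_iff {k : ℕ} (i j : Fin (k + 3)) :
    j = i + 1 ↔ (i.val + 1 = j.val ∨ (i.val = k + 2 ∧ j.val = 0)) := by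
  rw [Fin.ext_iff, Fin.val_add_one]
  split_ifs with h
  · rw [Fin.ext_iff, Fin.val_last] at h
    omega
  · rw [Fin.ext_iff, Fin.val_last] at h
    omega

section

variable {G : Type*} [Group G] {k : ℕ} {T : Fin (k + 3) → Set G}

/-- With at least three levels, forward and backward arcs out of a level go to different levels. A
bidirected edge therefore pairs a backward arc with the forward arc for 1, which is absent only from
the last level to level 0. The bidirected edges form one path for each g. -/
theorem cyclicDigraph_bidirected (h1 : ∀ i, (1 : G) ∈ T i ↔ i ≠ Fin.last _) (x y : G × Fin (k + 3)) :
    (cyclicDigraph T).Bidirected x y ↔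
      x.1 = y.1 ∧ (x.2.val + 1 = y.2.val ∨ y.2.val + 1 = x.2.val) := by
  obtain ⟨g, i⟩ := x
  obtain ⟨h, j⟩ := y
  have hi := i.2
  have hj := j.2
  simp only [Digraph.Bidirected, cyclicDigraph, Fin.eq_add_one_iff]
  constructor
  · rintro ⟨⟨h1', h2⟩ | ⟨h1', h2⟩, ⟨h3, h4⟩ | ⟨h3, h4⟩⟩
    · omega
    · subst h4
      have := (h1 i).1 (by simpa using h2)
      rw [Ne, Fin.ext_iff, Fin.val_last] at this
      exact ⟨rfl, by omega⟩
    · subst h2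
      have := (h1 j).1 (by simpa using h4)
      rw [Ne, Fin.ext_iff, Fin.val_last] at this
      exact ⟨rfl, by omega⟩
    · omega
  · rintro ⟨rfl, hij | hij⟩
    · refine ⟨Or.inl ⟨Or.inl hij, ?_⟩, Or.inr ⟨Or.inl hij, rfl⟩⟩
      rw [inv_mul_cancel, h1, Ne, Fin.ext_iff, Fin.val_last]
      omega
    · refine ⟨Or.inr ⟨Or.inl hij, rfl⟩, Or.inl ⟨Or.inl hij, ?_⟩⟩
      rw [inv_mul_cancel, h1, Ne, Fin.ext_iff, Fin.val_last]
      omega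

theorem cyclicDigraph_isEnd (h1 : ∀ i, (1 : G) ∈ T i ↔ i ≠ Fin.last _) (x : G × Fin (k + 3)) :
    (cyclicDigraph T).IsEnd x ↔ x.2.val = 0 ∨ x.2.val = k + 2 := by
  obtain ⟨g, i⟩ := x
  have hi := i.2
  simp only [Digraph.IsEnd, cyclicDigraph_bidirected h1]
  constructor
  · rintro ⟨y, -, hy⟩
    by_contra! hne
    have e1 := hy (g, ⟨i.val + 1, by omega⟩) ⟨rfl, Or.inl rfl⟩
    have e2 := hy (g, ⟨i.val - 1, by omega⟩) ⟨rfl, Or.inr (by simp; omega)⟩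
    rw [← e2] at e1
    simp only [Prod.mk.injEq, Fin.mk.injEq] at e1
    omega
  · rintro (h | h)
    · refine ⟨(g, ⟨1, by omega⟩), ⟨rfl, Or.inl (by simp only; omega)⟩, ?_⟩
      rintro ⟨g', j⟩ ⟨rfl, hj⟩
      simp only [Prod.mk.injEq, Fin.ext_iff, true_and]
      simp only at h hj
      omega
    · refine ⟨(g, ⟨k + 1, by omega⟩), ⟨rfl, Or.inr (by simp only; omega)⟩, ?_⟩
      rintro ⟨g', j⟩ ⟨rfl, hj⟩
      have := j.2
      simp only [Prod.mk.injEq, Fin.ext_iff, true_and]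
      simp only at h hj
      omega

/-- The ends of the path over g are joined by the backward arc from (g, 0) to (g, last), but not
conversely, since 1 is not in the last connection set. This arc orients the path. -/
theorem cyclicDigraph_isStart (h1 : ∀ i, (1 : G) ∈ T i ↔ i ≠ Fin.last _) (x : G × Fin (k + 3)) :
    (cyclicDigraph T).IsStart x ↔ x.2.val = 0 := by
  have hreach : ∀ y, Relation.ReflTransGen (cyclicDigraph T).Bidirected x y → x.1 = y.1 := by
    intro y hy
    induction hy with
    | refl => rfl
    | tail _ h ih => exact ih.trans ((cyclicDigraph_bidirected h1 _ _).1 h).1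
  obtain ⟨g, i⟩ := x
  simp only [Digraph.IsStart, cyclicDigraph_isEnd h1]
  constructor
  · rintro ⟨hx, ⟨h, j⟩, hy, hadj, hr⟩
    obtain rfl : g = h := hreach _ hr
    by_contra hne
    simp only [cyclicDigraph, Fin.eq_add_one_iff, inv_mul_cancel, h1] at hadj
    simp only [Fin.ext_iff, Ne, Fin.val_last] at hx hy hadj hne
    omega
  · intro h
    refine ⟨Or.inl h, (g, Fin.last _), Or.inr rfl, ?_, ?_⟩
    · simp only [cyclicDigraph, Fin.eq_add_one_iff, Fin.val_last]
      simp [h]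
    · have : ∀ t (ht : t < k + 3), Relation.ReflTransGen (cyclicDigraph T).Bidirected (g, i)
          (g, ⟨t, ht⟩) := by
        intro t
        induction t with
        | zero =>
          intro ht
          rw [show i = ⟨0, ht⟩ from Fin.ext h]
        | succ t ih =>
          intro ht
          refine (ih (by omega)).tail ?_
          rw [cyclicDigraph_bidirected h1]
          exact ⟨rfl, Or.inl rfl⟩
      exact this _ _

/-- Starts go to starts, and the bidirected paths then carry the action on level 0 unchanged to all
levels. -/
theorem cyclicDigraph_aut (h1 : ∀ i, (1 : G) ∈ T i ↔ i ≠ Fin.last _)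
    {σ : Equiv.Perm (G × Fin (k + 3))} (hσ : σ ∈ (cyclicDigraph T).autGroup) :
    ∃ τ : G → G, Function.Injective τ ∧ (∀ g i, σ (g, i) = (τ g, i)) ∧
      ∀ i g h, (τ g)⁻¹ * τ h ∈ T i ↔ g⁻¹ * h ∈ T i := by
  have h0 : ∀ g, σ (g, 0) = ((σ (g, 0)).1, 0) := by
    intro g
    refine Prod.ext rfl (Fin.ext ?_)
    exact (cyclicDigraph_isStart h1 _).1
      (Digraph.isStart_of_mem hσ ((cyclicDigraph_isStart h1 (g, 0)).2 rfl))
  have hall : ∀ t (ht : t < k + 3), ∀ g, σ (g, ⟨t, ht⟩) = ((σ (g, 0)).1, ⟨t, ht⟩) := by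
    intro t
    induction t using Nat.strong_induction_on with
    | _ t ih =>
      intro ht g
      cases t with
      | zero => exact h0 g
      | succ t =>
        have hb := (Digraph.bidirected_map hσ (g, ⟨t, by omega⟩) (g, ⟨t + 1, ht⟩)).2
          ((cyclicDigraph_bidirected h1 _ _).2 ⟨rfl, Or.inl rfl⟩)
        rw [ih t (by omega) (by omega), cyclicDigraph_bidirected h1] at hb
        obtain ⟨hb1, hb2⟩ := hb
        simp only at hb1 hb2
        rcases hb2 with hb2 | hb2
        · exact Prod.ext hb1.symm (Fin.ext hb2.symm)
        -- The only other neighbour along the path is already the image of the vertex at level t -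
        -- 1.
        · exfalso
          have hlt : t - 1 < k + 3 := by omega
          have e1 := ih (t - 1) (by omega) hlt g
          have e2 : σ (g, ⟨t + 1, ht⟩) = σ (g, ⟨t - 1, hlt⟩) := by
            rw [e1]
            exact Prod.ext hb1.symm (Fin.ext (by simp only; omega))
          have e3 := congrArg (fun y => y.2.val) (σ.injective e2)
          simp only at e3
          omega
  refine ⟨fun g => (σ (g, 0)).1, ?_, fun g i => hall i.1 i.2 g, ?_⟩
  · intro g h hgh
    have : σ (g, 0) = σ (h, 0) := by
      rw [h0 g, h0 h]
      exact Prod.ext hgh rfl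
    exact congrArg Prod.fst (σ.injective this)
  · intro i g h
    have hadj : ∀ g h, (cyclicDigraph T).Adj (g, i) (h, i + 1) ↔ g⁻¹ * h ∈ T i := by
      intro g h
      have hne : i ≠ i + 1 + 1 := by
        intro he
        rw [Fin.eq_add_one_iff] at he
        have := (Fin.eq_add_one_iff i (i + 1)).1 rfl
        have := i.2
        omega
      simp [cyclicDigraph, hne]
    rw [← hadj, ← hadj, ← hσ (g, i) (h, i + 1)]
    rw [show σ (g, i) = _ from hall i.1 i.2 g, show σ (h, i + 1) = _ from hall _ (i + 1).2 h]

end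

theorem cyclicDigraph_isRegular {G : Type*} [Group G] {k : ℕ} {T : Fin (k + 3) → Set G} {d : ℕ}
    (hd : ∀ i, (T i).encard = d) : (cyclicDigraph T).IsRegular := by
  have hne : ∀ i : Fin (k + 3), i ≠ i + 1 + 1 := by
    intro i he
    rw [Fin.eq_add_one_iff] at he
    have := (Fin.eq_add_one_iff i (i + 1)).1 rfl
    have := i.2
    omega
  refine ⟨d + 1, fun x => ⟨?_, ?_⟩⟩
  · have : {y | (cyclicDigraph T).Adj x y} =
        {y | y.2 = x.2 + 1 ∧ x.1⁻¹ * y.1 ∈ T x.2} ∪ {(x.1, x.2 - 1)} := by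
      ext ⟨h, j⟩
      simp [cyclicDigraph, eq_sub_iff_add_eq, eq_comm, and_comm, or_comm]
    rw [this, Set.encard_union_eq, encard_out, hd, Set.encard_singleton]
    · rfl
    · rw [Set.disjoint_singleton_right]
      rintro ⟨h, -⟩
      rw [sub_eq_iff_eq_add] at h
      exact hne _ h
  · have : {y | (cyclicDigraph T).Adj y x} =
        {y | y.2 = x.2 - 1 ∧ y.1⁻¹ * x.1 ∈ T (x.2 - 1)} ∪ {(x.1, x.2 + 1)} := by
      ext ⟨h, j⟩
      simp only [cyclicDigraph, Set.mem_ofPred_eq, Set.mem_union, Set.mem_singleton_iff,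
        Prod.mk.injEq, eq_sub_iff_add_eq]
      refine or_congr ?_ and_comm
      constructor
      · rintro ⟨h1, h2⟩
        exact ⟨h1.symm, by rwa [h1, add_sub_cancel_right]⟩
      · rintro ⟨h1, h2⟩
        exact ⟨h1.symm, by rwa [← h1, add_sub_cancel_right] at h2⟩
    rw [this, Set.encard_union_eq, encard_in, hd, Set.encard_singleton]
    · rfl
    · rw [Set.disjoint_singleton_right]
      rintro ⟨h, -⟩
      rw [eq_sub_iff_add_eq] at h
      exact hne _ h.symm

theorem admits_of_cyclicDigraph {G : Type u} [Group G] [Finite G] {k : ℕ}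
    {T : Fin (k + 3) → Set G} {d : ℕ} (hd : ∀ i, (T i).encard = d)
    (h1 : ∀ i, (1 : G) ∈ T i ↔ i ≠ Fin.last _) {R : Set G} (hR : Subgroup.closure R = ⊤)
    (hfix : ∀ τ : G → G, Function.Injective τ →
      (∀ i g h, (τ g)⁻¹ * τ h ∈ T i ↔ g⁻¹ * h ∈ T i) → τ 1 = 1 → ∀ r ∈ R, τ r = r) :
    AdmitsPartiteRepresentation.{u, v} G (k + 3) := by
  have hne : ∀ i : Fin (k + 3), i ≠ i + 1 := by
    intro i he
    rw [Fin.eq_add_one_iff] at he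
    omega
  have := admits_of_translations.{u, v} (cyclicDigraph T) (cyclicDigraph_isRegular hd) ?_ ?_ ?_
  · simpa using this
  · intro t x y
    simp [cyclicDigraph, mul_assoc]
  · intro σ hσ
    obtain ⟨τ, hinj, hστ, hτ⟩ := cyclicDigraph_aut h1 hσ
    refine ⟨τ 1, ?_⟩
    rintro ⟨g, i⟩
    rw [hστ]
    have := eq_mul_of_fixes_generators hR
      (P := fun τ => Function.Injective τ ∧ ∀ i g h, (τ g)⁻¹ * τ h ∈ T i ↔ g⁻¹ * h ∈ T i)
      ?_ (fun τ hτ => hfix τ hτ.1 hτ.2) ⟨hinj, hτ⟩ g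
    · rw [this]
    · rintro τ ⟨hi, h⟩ s t
      refine ⟨fun a b hab => ?_, fun i a b => ?_⟩
      · exact mul_left_cancel (hi (mul_left_cancel hab))
      · have := h i (t * a) (t * b)
        simpa [mul_assoc] using this
  · rintro ⟨g, i⟩ ⟨h, j⟩ hij hadj
    obtain rfl : i = j := hij
    rcases hadj with h | h
    · exact hne _ h.1
    · exact hne _ h.1

/-- The last connection set makes τ permute the generators, level 0 singles out x_0 as the generator
missing there, and level 1 carries the path. Adding 1 in all but the last set makes each set have m
elements. -/
theorem admits_of_three_le {G : Type u} [Group G] [Finite G] [Nontrivial G] {n : ℕ} (hn : 3 ≤ n) :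
    AdmitsPartiteRepresentation.{u, v} G n := by
  obtain ⟨k, rfl⟩ := Nat.exists_eq_add_of_le' hn
  obtain ⟨x, hx, -⟩ := exists_irredundantGenerators G
  set m := Group.rank G
  have hm : 0 < m := Group.rank_pos G
  have hone : (1 : G) ∉ x '' Set.Iio m := by
    rintro ⟨i, hi, h⟩
    exact hx.ne_one hi h
  let T : Fin (k + 3) → Set G := fun i =>
    if i = Fin.last _ then x '' Set.Iio m
    else if i = 0 then insert 1 (x '' (Set.Iio m \ {0}))
    else insert 1 (steps x m)
  have hone0 : (1 : G) ∉ x '' (Set.Iio m \ {0}) := fun h =>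
    hone (Set.image_mono Set.sdiff_subset h)
  have hTlast : T (Fin.last _) = x '' Set.Iio m := if_pos rfl
  have hT0 : T 0 = insert 1 (x '' (Set.Iio m \ {0})) := by
    have : (0 : Fin (k + 3)) ≠ Fin.last _ := by simp [Fin.ext_iff]
    simp [T, this]
  have hT1 : T 1 = insert 1 (steps x m) := by
    have h1 : (1 : Fin (k + 3)) ≠ Fin.last _ := by simp [Fin.ext_iff]
    have h2 : (1 : Fin (k + 3)) ≠ 0 := by simp
    simp [T, h1, h2]
  refine admits_of_cyclicDigraph (T := T) (d := m) ?_ ?_ hx.closure_eq ?_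
  · intro i
    simp only [T]
    split_ifs
    · exact hx.encard_gens
    · rw [Set.encard_insert_of_notMem hone0]
      have : (x '' (Set.Iio m \ {0})).encard + 1 = (x '' Set.Iio m).encard := by
        rw [← Set.encard_insert_of_notMem (a := x 0), ← Set.image_insert_eq]
        · rw [Set.insert_sdiff_singleton, Set.insert_eq_of_mem (Set.mem_Iio.2 hm)]
        · rintro ⟨i, ⟨hi, hi0⟩, h⟩
          exact hi0 (hx.injOn hi hm h)
      rw [this, hx.encard_gens]
    · rw [Set.encard_insert_of_notMem hx.one_notMem_steps, hx.encard_steps]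
      norm_cast
      omega
  · intro i
    simp only [T]
    split_ifs with h1 h2
    · simpa [h1] using hone
    · simp [h1]
    · simp [h1]
  · intro τ hinj hτ hτ1
    have hset : ∀ i g, τ g ∈ T i ↔ g ∈ T i := by
      intro i g
      have := hτ i 1 g
      simpa [hτ1] using this
    have hmaps : ∀ i < m, ∃ j < m, τ (x i) = x j := by
      intro i hi
      have := (hset (Fin.last _) (x i)).2 (by rw [hTlast]; exact ⟨i, hi, rfl⟩)
      rw [hTlast] at this
      obtain ⟨j, hj, h⟩ := this
      exact ⟨j, hj, h.symm⟩
    have h0 : τ (x 0) = x 0 := by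
      obtain ⟨j, hj, h⟩ := hmaps 0 hm
      by_cases hj0 : j = 0
      · rw [h, hj0]
      · have h2 : τ (x 0) ∈ T 0 := by
          rw [hT0, h]
          exact Or.inr ⟨j, ⟨hj, hj0⟩, rfl⟩
        rw [hset, hT0] at h2
        rcases h2 with h2 | ⟨i, ⟨hi, hi0⟩, h2⟩
        · exact absurd h2 (hx.ne_one hm)
        · exact absurd (hx.injOn hi hm h2) hi0
    have := hx.fixes_of_path (Q := insert 1 (steps x m)) (Set.subset_insert _ _) ?_ hinj hmaps h0
      (fun g h hgh => by rw [← hT1] at hgh ⊢; exact (hτ 1 g h).2 hgh)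
    · rintro _ ⟨i, hi, rfl⟩
      exact this i hi
    · intro a ha b hb hab
      rcases hab with hab | hab
      · exact Or.inl (hx.injOn ha hb (inv_mul_eq_one.1 hab))
      · exact Or.inr (hx.quotient_mem_steps ha hb hab)

/-! ### Two parts: constructions -/

/-- The digraph on `G × Bool` with arcs `(g, false) → (g * r, true)` for `r ∈ R ∪ {1}` and
`(g * l, true) → (g, false)` for `l ∈ L ∪ {1}`. -/
def haarDigraph {G : Type*} [Group G] (R L : Set G) : Digraph (G × Bool) :=
  ⟨fun x y => (x.2 = false ∧ y.2 = true ∧ x.1⁻¹ * y.1 ∈ insert 1 R) ∨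
    (x.2 = true ∧ y.2 = false ∧ y.1⁻¹ * x.1 ∈ insert 1 L)⟩

theorem haarDigraph_isRegular {G : Type*} [Group G] {R L : Set G} {d : ℕ}
    (hR1 : (1 : G) ∉ R) (hL1 : (1 : G) ∉ L) (hR : R.encard = d) (hL : L.encard = d) :
    (haarDigraph R L).IsRegular := by
  have hR' : (insert 1 R).encard = ((d + 1 : ℕ) : ℕ∞) := by
    rw [Set.encard_insert_of_notMem hR1, hR]; rfl
  have hL' : (insert 1 L).encard = ((d + 1 : ℕ) : ℕ∞) := by
    rw [Set.encard_insert_of_notMem hL1, hL]; rfl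
  refine ⟨d + 1, ?_⟩
  rintro ⟨g, i⟩
  cases i
  · constructor
    · rw [← hR', ← encard_out g true]
      simp [haarDigraph]
    · rw [← hL', ← encard_out g true]
      simp [haarDigraph]
  · constructor
    · rw [← hL', ← encard_in g false]
      simp [haarDigraph]
    · rw [← hR', ← encard_in g false]
      simp [haarDigraph]

/-- Disjointness leaves 1 as the only difference realised by arcs in both directions. -/
theorem haarDigraph_bidirected {G : Type*} [Group G] {R L : Set G}
    (hRL : Disjoint R L) (x y : G × Bool) :
    (haarDigraph R L).Bidirected x y ↔ y = (x.1, !x.2) := by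
  have key : ∀ c : G, c ∈ insert 1 R → c ∈ insert 1 L → c = 1 := by
    rintro c (h | h) (h' | h')
    · exact h
    · exact h
    · exact h'
    · exact absurd h' (Set.disjoint_left.1 hRL h)
  obtain ⟨g, i⟩ := x
  obtain ⟨h, j⟩ := y
  simp only [Digraph.Bidirected, haarDigraph, Prod.mk.injEq]
  cases i <;> cases j <;> simp only [Bool.not_true, Bool.not_false, reduceCtorEq, false_and,
    and_false, or_self, true_and, or_false, false_or, and_true]
  · exact ⟨fun hh => (inv_mul_eq_one.1 (key _ hh.1 hh.2)).symm, fun hh => by simp [hh]⟩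
  · exact ⟨fun hh => (inv_mul_eq_one.1 (key _ hh.2 hh.1)), fun hh => by simp [hh]⟩

/-- The bidirected edges match (g, false) with (g, true), so the action on one level determines the
other. As `R` generates `G`, whether the levels are exchanged does not depend on g. -/
theorem haarDigraph_aut {G : Type*} [Group G] {R L : Set G}
    (hRL : Disjoint R L) (hR : Subgroup.closure R = ⊤)
    {σ : Equiv.Perm (G × Bool)} (hσ : σ ∈ (haarDigraph R L).autGroup) :
    ∃ (τ : G → G) (b : Bool), Function.Injective τ ∧ ∀ g i, σ (g, i) = (τ g, i ^^ b) := by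
  have hflip : ∀ g i, σ (g, !i) = ((σ (g, i)).1, !(σ (g, i)).2) := by
    intro g i
    rw [← haarDigraph_bidirected hRL, Digraph.bidirected_map hσ,
      haarDigraph_bidirected hRL]
  have hlevel : ∀ x y, (haarDigraph R L).Adj x y → y.2 = !x.2 := by
    rintro ⟨g, i⟩ ⟨h, j⟩ (⟨h1, h2, -⟩ | ⟨h1, h2, -⟩) <;> simp_all
  have hstep : ∀ g, ∀ r ∈ R, (σ (g * r, false)).2 = (σ (g, false)).2 := by
    intro g r hr
    have h1 : (haarDigraph R L).Adj (g, false) (g * r, true) :=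
      Or.inl ⟨rfl, rfl, by simp [hr]⟩
    have h2 := hlevel _ _ ((hσ _ _).2 h1)
    rw [show (g * r, true) = (g * r, !false) from rfl, hflip] at h2
    simpa using h2
  have hall : ∀ c ∈ Subgroup.closure R, ∀ g, (σ (g * c, false)).2 = (σ (g, false)).2 := by
    intro c hc
    induction hc using Subgroup.closure_induction with
    | mem r hr => exact fun g => hstep g r hr
    | one => simp
    | mul a b _ _ iha ihb =>
      intro g
      rw [← mul_assoc, ihb, iha]
    | inv a _ iha =>
      intro g
      have := iha (g * a⁻¹)
      rw [inv_mul_cancel_right] at this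
      exact this.symm
  have hconst : ∀ g, (σ (g, false)).2 = (σ (1, false)).2 := by
    intro g
    simpa using hall g (hR ▸ Subgroup.mem_top g) 1
  refine ⟨fun g => (σ (g, false)).1, (σ (1, false)).2, ?_, ?_⟩
  · intro g h hgh
    exact congrArg Prod.fst (σ.injective (Prod.ext hgh ((hconst g).trans (hconst h).symm)))
  · intro g i
    cases i
    · exact Prod.ext rfl (by simp [hconst g])
    · rw [show (g, true) = (g, !false) from rfl, hflip, hconst]
      simp

theorem admits_of_haarDigraph {G : Type u} [Group G] [Finite G] {R L : Set G}
    (hR1 : (1 : G) ∉ R) (hL1 : (1 : G) ∉ L) (hRL : Disjoint R L)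
    (hcard : R.encard = L.encard) (hgen : Subgroup.closure R = ⊤)
    (hfix : ∀ τ : G → G, Function.Injective τ →
      (∀ g h, (τ g)⁻¹ * τ h ∈ R ↔ g⁻¹ * h ∈ R) → (∀ g h, (τ g)⁻¹ * τ h ∈ L ↔ g⁻¹ * h ∈ L) →
      τ 1 = 1 → ∀ r ∈ R, τ r = r)
    (hswap : ∀ τ : G → G, Function.Injective τ →
      (∀ g h, (τ h)⁻¹ * τ g ∈ L ↔ g⁻¹ * h ∈ R) → (∀ g h, (τ h)⁻¹ * τ g ∈ R ↔ g⁻¹ * h ∈ L) →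
      τ 1 ≠ 1) :
    AdmitsPartiteRepresentation.{u, v} G 2 := by
  have hadj1 : ∀ g h, g ≠ h → ((haarDigraph R L).Adj (g, false) (h, true) ↔ g⁻¹ * h ∈ R) := by
    intro g h hgh
    simp [haarDigraph, inv_mul_eq_one, hgh]
  have hadj2 : ∀ g h, g ≠ h → ((haarDigraph R L).Adj (h, true) (g, false) ↔ g⁻¹ * h ∈ L) := by
    intro g h hgh
    simp [haarDigraph, inv_mul_eq_one, hgh]
  have hreg : (haarDigraph R L).IsRegular :=
    haarDigraph_isRegular (d := R.ncard) hR1 hL1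
      (Set.toFinite R).cast_ncard_eq.symm (hcard ▸ (Set.toFinite R).cast_ncard_eq.symm)
  have := admits_of_translations.{u, v} (haarDigraph R L) hreg ?_ ?_ ?_
  · simpa using this
  · intro t x y
    simp [haarDigraph, mul_assoc]
  · intro σ hσ
    obtain ⟨τ, b, hinj, hστ⟩ := haarDigraph_aut hRL hgen hσ
    cases b
    · refine ⟨τ 1, ?_⟩
      rintro ⟨g, i⟩
      rw [hστ, Bool.xor_false]
      have := eq_mul_of_fixes_generators hgen
        (P := fun τ => Function.Injective τ ∧ (∀ g h, (τ g)⁻¹ * τ h ∈ R ↔ g⁻¹ * h ∈ R) ∧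
          ∀ g h, (τ g)⁻¹ * τ h ∈ L ↔ g⁻¹ * h ∈ L)
        ?_ (fun τ hτ => hfix τ hτ.1 hτ.2.1 hτ.2.2) ⟨hinj, fun g h => ?_, fun g h => ?_⟩ g
      · rw [this]
      · rintro τ ⟨hi, h1, h2⟩ s t
        refine ⟨fun a b hab => ?_, fun a b => ?_, fun a b => ?_⟩
        · exact mul_left_cancel (hi (mul_left_cancel hab))
        · simpa [mul_assoc] using h1 (t * a) (t * b)
        · simpa [mul_assoc] using h2 (t * a) (t * b)
      · rcases eq_or_ne g h with rfl | hgh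
        · simp
        · have := hσ (g, false) (h, true)
          rwa [hστ, hστ, Bool.xor_false, Bool.xor_false, hadj1 g h hgh,
            hadj1 _ _ (hinj.ne hgh)] at this
      · rcases eq_or_ne g h with rfl | hgh
        · simp
        · have := hσ (h, true) (g, false)
          rwa [hστ, hστ, Bool.xor_false, Bool.xor_false, hadj2 g h hgh,
            hadj2 _ _ (hinj.ne hgh)] at this
    · exfalso
      -- Normalising an exchange of levels so that it fixes 1 contradicts `hswap`.
      refine hswap (fun g => (τ 1)⁻¹ * τ g) (fun a b hab => hinj (mul_left_cancel hab))
        (fun g h => ?_) (fun g h => ?_) (by simp)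
      · rcases eq_or_ne g h with rfl | hgh
        · simp [hR1, hL1]
        · have := hσ (g, false) (h, true)
          rw [hστ, hστ, hadj1 g h hgh] at this
          simpa [mul_assoc, ← hadj2 _ _ (hinj.ne hgh.symm)] using this
      · rcases eq_or_ne g h with rfl | hgh
        · simp [hR1, hL1]
        · have := hσ (h, true) (g, false)
          rw [hστ, hστ, hadj2 g h hgh] at this
          simpa [mul_assoc, ← hadj1 _ _ (hinj.ne hgh.symm)] using this
  · rintro ⟨g, i⟩ ⟨h, j⟩ hij hadj
    obtain rfl : i = j := hij
    rcases hadj with ⟨h1, h2, -⟩ | ⟨h1, h2, -⟩ <;> exact absurd (h1.symm.trans h2) (by simp)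

/-- Take R = {x} and L = {x²} for a generator x. An exchange fixing 1 would send x to x⁻² and x² to
x⁻¹; the difference from x to x² then forces x³ = 1, impossible for order at least 4. -/
theorem admits_two_of_isCyclic {G : Type u} [Group G] [Finite G] [IsCyclic G]
    (hG : 4 ≤ Nat.card G) : AdmitsPartiteRepresentation.{u, v} G 2 := by
  obtain ⟨x, hx⟩ := IsCyclic.exists_zpow_surjective (G := G)
  have hord : orderOf x = Nat.card G := orderOf_eq_card_of_forall_mem_zpowers fun g => hx g
  have hpow : ∀ k, 0 < k → k < 4 → x ^ k ≠ 1 := fun k h0 h4 h =>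
    absurd (orderOf_le_of_pow_eq_one h0 h) (by omega)
  have h1 : x ≠ 1 := by simpa using hpow 1 (by omega) (by omega)
  have h2 := hpow 2 (by omega) (by omega)
  have h3 := hpow 3 (by omega) (by omega)
  refine admits_of_haarDigraph (R := {x}) (L := {x ^ 2}) (Ne.symm h1) (Ne.symm h2) ?_ ?_ ?_ ?_ ?_
  · rw [Set.disjoint_singleton, pow_two]
    simpa using h1
  · simp
  · rw [eq_top_iff, ← Subgroup.zpowers_eq_closure]
    exact fun g _ => hx g
  · rintro τ - hτ - h r hr
    rw [Set.mem_singleton_iff.1 hr]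
    simpa [h] using hτ 1 x
  · rintro τ - hR hL h
    have a1 : τ x = (x ^ 2)⁻¹ := by
      have := (hR 1 x).2 (by simp)
      rw [h, Set.mem_singleton_iff, mul_one] at this
      rw [← this, inv_inv]
    have a2 : (τ (x ^ 2))⁻¹ * τ x = x ^ 2 := (hR x (x ^ 2)).2 (by simp [pow_two])
    have a3 : (τ (x ^ 2))⁻¹ = x := by
      have := (hL 1 (x ^ 2)).2 (by simp)
      simpa [h] using this
    rw [a3, a1, mul_inv_eq_iff_eq_mul, ← pow_add] at a2
    apply h3
    have : x * x ^ 3 = x * 1 := by rw [← pow_succ', mul_one]; exact a2.symm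
    exact mul_left_cancel this

theorem IrredundantGenerators.one_notMem {G : Type*} [Group G] {x : ℕ → G} {m : ℕ}
    (hx : IrredundantGenerators x m) : (1 : G) ∉ x '' Set.Iio m := by
  rintro ⟨i, hi, h⟩
  exact hx.ne_one hi h

/-- The extra element x_0⁻¹ of `L` marks x_0 as the only generator whose inverse lies in `L`. The
condition x_0² ≠ 1 keeps `R` and `L` disjoint, and also excludes an exchange of levels. -/
theorem IrredundantGenerators.admits_two_of_sq_ne_one {G : Type u} [Group G] [Finite G] {x : ℕ → G}
    {m : ℕ} (hx : IrredundantGenerators x m) (hm : 2 ≤ m) (h0 : x 0 ^ 2 ≠ 1) :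
    AdmitsPartiteRepresentation.{u, v} G 2 := by
  have hm0 : 0 < m := by omega
  set R := x '' Set.Iio m with hRdef
  set L := insert (x 0)⁻¹ (steps x m) with hLdef
  have hinvL : ∀ j < m, (x j)⁻¹ ∈ L → j = 0 := by
    rintro j hj (h | h)
    · exact hx.injOn hj hm0 (inv_injective h)
    · obtain ⟨i, hi, h⟩ := mem_steps.1 h
      refine absurd ?_ (hx.quotient_ne_single (a := i) (b := i + 1) (by omega) hi hj)
      rw [← inv_inv (x j), ← h]
      simp
  have h0L : (x 0)⁻¹ ∉ steps x m := by
    intro h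
    obtain ⟨i, hi, h⟩ := mem_steps.1 h
    refine absurd ?_ (hx.quotient_ne_single (a := i) (b := i + 1) (by omega) hi hm0)
    rw [← inv_inv (x 0), ← h]
    simp
  refine admits_of_haarDigraph (R := R) (L := L) hx.one_notMem ?_ ?_ ?_ hx.closure_eq ?_ ?_
  · rintro (h | h)
    · exact hx.ne_one hm0 (inv_eq_one.1 h.symm)
    · exact hx.one_notMem_steps h
  · rw [Set.disjoint_left]
    rintro _ ⟨i, hi, rfl⟩ (h | h)
    · by_cases hi0 : i = 0
      · rw [hi0] at h
        exact h0 (by rw [pow_two]; nth_rw 1 [h]; simp)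
      · exact hx.single_ne_inv hi hm0 hi0 h
    · exact hx.gen_notMem_steps hi h
  · rw [hx.encard_gens, Set.encard_insert_of_notMem h0L, hx.encard_steps]
    norm_cast
    omega
  · intro τ hinj hR hL hτ1
    have hmaps : ∀ i < m, ∃ j < m, τ (x i) = x j := by
      intro i hi
      have := (hR 1 (x i)).2 ⟨i, hi, by simp⟩
      rw [hτ1, inv_one, one_mul] at this
      obtain ⟨j, hj, h⟩ := this
      exact ⟨j, hj, h.symm⟩
    have h00 : τ (x 0) = x 0 := by
      obtain ⟨j, hj, h⟩ := hmaps 0 hm0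
      have h1 := (hL (x 0) 1).2 (by simp [hLdef])
      rw [hτ1, mul_one, h] at h1
      rw [h, hinvL j hj h1]
    have := hx.fixes_of_path (Q := L) (Set.subset_insert _ _) ?_ hinj hmaps h00
      (fun g h hgh => (hL g h).2 hgh)
    · rintro _ ⟨i, hi, rfl⟩
      exact this i hi
    · rintro a ha b hb (hab | hab)
      · refine absurd ?_ (hx.quotient_ne_single (a := b) (b := a) hb ha hm0)
        rw [← inv_inv (x 0), ← hab]
        simp
      · exact Or.inr (hx.quotient_mem_steps ha hb hab)
  · intro τ hinj hR hL hτ1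
    have h00 : τ (x 0) = x 0 := by
      have h1 := (hL (x 0) 1).2 (by simp [hLdef])
      rw [hτ1, inv_one, one_mul] at h1
      obtain ⟨j, hj, h⟩ := h1
      have h2 := (hR 1 (x 0)).2 ⟨0, hm0, by simp⟩
      rw [hτ1, mul_one, ← h] at h2
      rw [← h, hinvL j hj h2]
    -- An exchange fixes x_0, and the step between x_1 and x_0 gives τ(x_1) = x_0 x_k. Its inverse
    -- must lie in `L`, which forces x_k = 1 or x_0⁻¹ = x_0.
    have h1 := (hL (x 1) (x 0)).2 (Or.inr (mem_steps.2 ⟨0, by omega, rfl⟩))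
    rw [h00] at h1
    obtain ⟨k, hk, h1⟩ := h1
    have h2 : τ (x 1) = x 0 * x k := by rw [h1, mul_inv_cancel_left]
    have h3 := (hR 1 (x 1)).2 ⟨1, hm, by simp⟩
    rw [hτ1, mul_one, h2] at h3
    rcases h3 with h3 | h3
    · exact hx.ne_one hk (by simpa using h3)
    · obtain ⟨i, hi, h3⟩ := mem_steps.1 h3
      have h4 : (x i)⁻¹ * x (i + 1) = x 0 * x k := by
        rw [← inv_inv (x 0 * x k), ← h3]
        simp
      have h5 := hx.mul_eq_quotient (by omega) hi hm0 hk (by omega) h4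
      obtain ⟨rfl, rfl⟩ : i = 0 ∧ k = i + 1 := by omega
      have h6 := mul_right_cancel h4
      exact h0 (by rw [pow_two]; nth_rw 1 [← h6]; simp)

/-- Modulo 2, the set {0, 2, 3} is the sum of {a, a + 1} and {e}. Its only pair of consecutive
indices is {2, 3}, which leaves e = 0. -/
theorem IrredundantGenerators.eq_zero_of_word {G : Type*} [CommGroup G] {x : ℕ → G} {m : ℕ}
    (hx : IrredundantGenerators x m) (hexp : ∀ g : G, g ^ 2 = 1) (hm : 4 ≤ m) {a e : ℕ}
    (ha : a + 1 < m) (he : e < m)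
    (h : (([0, 2, 3, a + 1, a, e] : List ℕ).map x).prod = 1) : e = 0 := by
  have hl : ∀ i ∈ ([0, 2, 3, a + 1, a, e] : List ℕ), i < m := by
    simp
    omega
  have c0 := hx.even_count hexp hl h 0
  have c2 := hx.even_count hexp hl h 2
  have c3 := hx.even_count hexp hl h 3
  simp only [List.count_cons, List.count_nil, beq_iff_eq, Nat.even_iff] at c0 c2 c3
  clear hl h hx hexp
  grind

theorem IrredundantGenerators.admits_two_of_exponent_two {G : Type u} [CommGroup G] [Finite G]
    {x : ℕ → G} {m : ℕ} (hx : IrredundantGenerators x m) (hexp : ∀ g : G, g ^ 2 = 1)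
    (hm : 4 ≤ m) : AdmitsPartiteRepresentation.{u, v} G 2 := by
  have hm0 : 0 < m := by omega
  have hinv : ∀ g : G, g⁻¹ = g := fun g => by
    rw [inv_eq_iff_mul_eq_one, ← pow_two, hexp]
  have hself : ∀ g : G, g * g = 1 := fun g => by rw [← pow_two, hexp]
  set y := x 0 * (x 2 * x 3) with hy
  set R := x '' Set.Iio m with hRdef
  set L := insert y (steps x m) with hLdef
  have hodd : ∀ l : List ℕ, (∀ i ∈ l, i < m) → Odd l.length → (l.map x).prod ≠ 1 :=
    fun l hl ho h => Nat.not_even_iff_odd.2 ho (hx.even_length hexp hl h)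
  have hyR : ∀ a < m, ∀ b < m, (x a)⁻¹ * x b ≠ y := by
    intro a ha b hb h
    refine hodd [a, b, 0, 2, 3] (by simp; omega) ⟨2, rfl⟩ ?_
    simp only [List.map_cons, List.map_nil, List.prod_cons, List.prod_nil, mul_one]
    rw [← hy, ← h, hinv, ← mul_assoc, hself]
  have hyL : y ∉ steps x m := by
    rw [mem_steps]
    rintro ⟨i, hi, h⟩
    exact hyR _ hi _ (by omega) h
  -- `x 0` is determined in `R` by the triangle below
  have huniq : ∀ r ∈ R, ∀ l ∈ L, ∀ l' ∈ L, l⁻¹ * l' ∈ R → r⁻¹ * l' ∈ L → r = x 0 := by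
    rintro _ ⟨c, hc, rfl⟩ l hl l' hl' ⟨e, he, h1⟩ h2
    rw [Set.mem_Iio] at hc he
    rw [hinv] at h1 h2
    have h1' : l * l' * x e = 1 := by rw [h1, hself]
    -- Generators and `y` are odd words and steps are even, so exactly one of `l`, `l'` is `y`. The
    -- condition on `r⁻¹ * l'` then either violates parity, or makes a generator trivial, or gives
    -- the word of `eq_zero_of_word`.
    rcases hl with rfl | hl <;> rcases hl' with rfl | hl'
    · rw [hself, one_mul] at h1'
      exact absurd h1' (hx.ne_one he)
    · obtain ⟨a, ha, rfl⟩ := mem_steps.1 hl'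
      rcases h2 with h2 | h2
      · rw [hx.eq_zero_of_word hexp hm ha hc]
        simp only [List.map_cons, List.map_nil, List.prod_cons, List.prod_nil, mul_one]
        rw [hinv] at h2
        calc _ = (x c * (x (a + 1) * x a)) * y := by rw [hy]; ac_rfl
          _ = 1 := by rw [h2, hself]
      · obtain ⟨b, hb, h2⟩ := mem_steps.1 h2
        exfalso
        refine hodd [c, a + 1, a, b + 1, b] (by simp; omega) ⟨2, rfl⟩ ?_
        simp only [List.map_cons, List.map_nil, List.prod_cons, List.prod_nil, mul_one]
        rw [hinv, hinv] at h2
        calc _ = (x c * (x (a + 1) * x a)) * (x (b + 1) * x b) := by ac_rfl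
          _ = 1 := by rw [h2, hself]
    · obtain ⟨a, ha, rfl⟩ := mem_steps.1 hl
      rcases h2 with h2 | h2
      · exact absurd (mul_eq_right.1 h2) (hx.ne_one hc)
      · obtain ⟨b, hb, h2⟩ := mem_steps.1 h2
        rw [hx.eq_zero_of_word hexp hm hb hc]
        simp only [List.map_cons, List.map_nil, List.prod_cons, List.prod_nil, mul_one]
        rw [hinv] at h2
        calc _ = (x c * y) * (x (b + 1) * x b) := by rw [hy]; ac_rfl
          _ = 1 := by rw [h2, hself]
    · obtain ⟨a, ha, rfl⟩ := mem_steps.1 hl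
      obtain ⟨b, hb, rfl⟩ := mem_steps.1 hl'
      exfalso
      refine hodd [a + 1, a, b + 1, b, e] (by simp; omega) ⟨2, rfl⟩ ?_
      simp only [List.map_cons, List.map_nil, List.prod_cons, List.prod_nil, mul_one]
      rw [hinv, hinv] at h1'
      rw [← h1']
      ac_rfl
  refine admits_of_haarDigraph (R := R) (L := L) hx.one_notMem ?_ ?_ ?_ hx.closure_eq ?_ ?_
  · rintro (h | h)
    · exact hyR 0 hm0 0 hm0 (by rw [inv_mul_cancel, h])
    · exact hx.one_notMem_steps h
  · rw [Set.disjoint_left]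
    rintro _ ⟨i, hi, rfl⟩ (h | h)
    · have hy1 : y * x i = 1 := by rw [← h, hself]
      rw [Set.mem_Iio] at hi
      have c := fun k => hx.even_count hexp (l := [0, 2, 3, i]) (by simp; omega)
        (by simpa [hy, mul_assoc] using hy1) k
      have c0 := c 0
      have c2 := c 2
      simp only [List.count_cons, List.count_nil, beq_iff_eq, Nat.even_iff] at c0 c2
      split_ifs at c0 c2 <;> omega
    · exact hx.gen_notMem_steps hi h
  · rw [hx.encard_gens, Set.encard_insert_of_notMem hyL, hx.encard_steps]
    norm_cast
    omega
  · intro τ hinj hR hL hτ1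
    have hsetR : ∀ g ∈ R, τ g ∈ R := fun g hg => by
      simpa [hτ1] using (hR 1 g).2 (by simpa using hg)
    have hsetL : ∀ g ∈ L, τ g ∈ L := fun g hg => by
      simpa [hτ1] using (hL 1 g).2 (by simpa using hg)
    have hmaps : ∀ i < m, ∃ j < m, τ (x i) = x j := by
      intro i hi
      obtain ⟨j, hj, h⟩ := hsetR _ ⟨i, hi, rfl⟩
      exact ⟨j, hj, h.symm⟩
    have hstep : (x 3)⁻¹ * x 2 ∈ L := Or.inr (mem_steps.2 ⟨2, by omega, rfl⟩)
    -- The triangle with l = x_3⁻¹ x_2, l' = y and r = x_0 exists, since l⁻¹ y = x_0 and x_0⁻¹ y =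
    -- x_2 x_3; its image under τ satisfies `huniq`.
    have h00 : τ (x 0) = x 0 := by
      refine huniq _ (hsetR _ ⟨0, hm0, rfl⟩) _ (hsetL _ hstep) (τ y) (hsetL y (Or.inl rfl))
        ((hR _ _).2 ⟨0, hm0, ?_⟩) ((hL _ _).2 ?_)
      · rw [hy, hinv, hinv, show x 3 * x 2 * (x 0 * (x 2 * x 3)) =
          (x 3 * x 3) * ((x 2 * x 2) * x 0) by ac_rfl, hself, hself, one_mul, one_mul]
      · rw [hy, inv_mul_cancel_left, mul_comm, ← hinv (x 3)]
        exact hstep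
    have := hx.fixes_of_path (Q := L) (Set.subset_insert _ _) ?_ hinj hmaps h00
      (fun g h hgh => (hL g h).2 hgh)
    · rintro _ ⟨i, hi, rfl⟩
      exact this i hi
    · rintro a ha b hb (hab | hab)
      · exact absurd hab (hyR a ha b hb)
      · exact Or.inr (hx.quotient_mem_steps ha hb hab)
  · intro τ hinj hR hL hτ1
    have hflip : ∀ g h : G, g⁻¹ * h = h⁻¹ * g := fun g h => by rw [hinv, hinv, mul_comm]
    have hsetR : ∀ g ∈ R, τ g ∈ L := fun g hg => by
      simpa [hτ1, hinv] using (hR 1 g).2 (by simpa using hg)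
    have hsetL : ∀ g ∈ L, τ g ∈ R := fun g hg => by
      simpa [hτ1, hinv] using (hL 1 g).2 (by simpa using hg)
    -- An exchange turns the step between x_{i+1} and x_i, together with these two generators, into
    -- a triangle of `huniq`. All steps would then have the same image, against injectivity.
    have key : ∀ i, i + 1 < m → τ ((x (i + 1))⁻¹ * x i) = x 0 := by
      intro i hi
      have hstep : (x (i + 1))⁻¹ * x i ∈ L := Or.inr (mem_steps.2 ⟨i, hi, rfl⟩)
      refine huniq _ (hsetL _ hstep) _ (hsetR _ ⟨i + 1, hi, rfl⟩) (τ (x i))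
        (hsetR _ ⟨i, (by omega : i < m), rfl⟩) ?_ ?_
      · rw [hflip, hL]
        exact hstep
      · rw [hflip, hR]
        exact ⟨i + 1, hi, by simp⟩
    have h1 := hinj ((key 0 (by omega)).trans (key 1 (by omega)).symm)
    have := hx.quotient_eq_quotient (by omega) (by omega) (by omega) (by omega) (by omega) h1
    omega

/-! ### Groups missed by the two-part constructions -/

theorem mulEquiv_zmod_one {G : Type*} [Group G] (h : Nat.card G = 1) :
    Nonempty (G ≃* Multiplicative (ZMod 1)) := by
  have h1 := (Nat.card_eq_one_iff_unique.1 h)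
  have := h1.1
  have : Unique (Multiplicative (ZMod 1)) := inferInstanceAs (Unique (Fin 1))
  have : Unique G := uniqueOfSubsingleton 1
  exact ⟨MulEquiv.ofUnique⟩

/-- The group is a vector space over the field of two elements; group generators span it, so its
dimension is at most the rank. -/
theorem mulEquiv_or_four_le_rank {G : Type*} [CommGroup G] [Finite G]
    (hexp : ∀ g : G, g ^ 2 = 1) :
    4 ≤ Group.rank G ∨ Nonempty (G ≃* Multiplicative (ZMod 1)) ∨
      Nonempty (G ≃* Multiplicative (ZMod 2)) ∨
      Nonempty (G ≃* Multiplicative (ZMod 2 × ZMod 2)) ∨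
      Nonempty (G ≃* Multiplicative (ZMod 2 × ZMod 2 × ZMod 2)) := by
  let : Module (ZMod 2) (Additive G) := AddCommGroup.zmodModule fun g => hexp g.toMul
  have : Module.Finite (ZMod 2) (Additive G) := Module.Finite.of_finite
  have hiso : ∀ (M : Type) [AddCommGroup M] [Module (ZMod 2) M] [Module.Finite (ZMod 2) M],
      Module.finrank (ZMod 2) (Additive G) = Module.finrank (ZMod 2) M →
      Nonempty (G ≃* Multiplicative M) := fun M _ _ _ h =>
    ⟨AddEquiv.toMultiplicativeRight (LinearEquiv.ofFinrankEq _ _ h).toAddEquiv⟩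
  have hrank : Module.finrank (ZMod 2) (Additive G) ≤ Group.rank G := by
    classical
    obtain ⟨S, hS, hcl⟩ := Group.rank_spec G
    have hspan : Submodule.span (ZMod 2) (Additive.toMul ⁻¹' (S : Set G)) = ⊤ := by
      rw [eq_top_iff]
      intro g _
      have hg : g.toMul ∈ Subgroup.closure (S : Set G) := hcl ▸ Subgroup.mem_top _
      have key : ∀ h ∈ Subgroup.closure (S : Set G),
          Additive.ofMul h ∈ Submodule.span (ZMod 2) (Additive.toMul ⁻¹' (S : Set G)) := by
        intro h hh
        induction hh using Subgroup.closure_induction with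
        | mem s hs => exact Submodule.subset_span hs
        | one => exact zero_mem _
        | mul a b _ _ ha hb => exact add_mem ha hb
        | inv a _ ha => exact neg_mem ha
      exact key _ hg
    have hset : Additive.toMul ⁻¹' (S : Set G) =
        ((S.map Additive.ofMul.toEmbedding : Finset (Additive G)) : Set (Additive G)) := by
      ext g
      simp
    rw [← hS, ← finrank_top, ← hspan, hset, ← Finset.card_map Additive.ofMul.toEmbedding]
    exact finrank_span_finset_le_card _
  by_cases h4 : 4 ≤ Module.finrank (ZMod 2) (Additive G)
  · exact Or.inl (h4.trans hrank)
  · right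
    obtain h | h | h | h : Module.finrank (ZMod 2) (Additive G) = 0 ∨
      Module.finrank (ZMod 2) (Additive G) = 1 ∨ Module.finrank (ZMod 2) (Additive G) = 2 ∨
      Module.finrank (ZMod 2) (Additive G) = 3 := by omega
    · left
      refine mulEquiv_zmod_one ?_
      rw [Module.finrank_zero_iff] at h
      have : Subsingleton G := Additive.toMul.symm.subsingleton
      exact Nat.card_unique
    · exact Or.inr (Or.inl (hiso _ (by simp [h])))
    · exact Or.inr (Or.inr (Or.inl (hiso _ (by simp [h]))))
    · exact Or.inr (Or.inr (Or.inr (hiso _ (by simp [h]))))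

theorem mulEquiv_zmod_three {G : Type*} [Group G] (h : Nat.card G = 3) :
    Nonempty (G ≃* Multiplicative (ZMod 3)) := by
  have : Fact (Nat.Prime 3) := ⟨Nat.prime_three⟩
  have := isCyclic_of_prime_card h
  exact ⟨(zmodCyclicMulEquiv this).symm.trans (by rw [h])⟩

theorem admits_two_or_exceptional (G : Type u) [Group G] [Finite G] :
    AdmitsPartiteRepresentation.{u, v} G 2 ∨
      Nonempty (G ≃* Multiplicative (ZMod 1)) ∨
      Nonempty (G ≃* Multiplicative (ZMod 2)) ∨
      Nonempty (G ≃* Multiplicative (ZMod 3)) ∨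
      Nonempty (G ≃* Multiplicative (ZMod 2 × ZMod 2)) ∨
      Nonempty (G ≃* Multiplicative (ZMod 2 × ZMod 2 × ZMod 2)) := by
  obtain ⟨x, hx, hx0⟩ := exists_irredundantGenerators G
  by_cases hexp : ∃ g : G, g ^ 2 ≠ 1
  · by_cases hr : 2 ≤ Group.rank G
    · exact Or.inl (hx.admits_two_of_sq_ne_one hr (hx0 hexp))
    -- Rank at most 1 makes the group cyclic. Orders 1 and 2 contradict the element with nontrivial
    -- square, so below order 4 only order 3 is left.
    · have hcyc : IsCyclic G := by
        refine ⟨x 0, fun g => ?_⟩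
        have hle : Subgroup.closure (x '' Set.Iio (Group.rank G)) ≤ Subgroup.zpowers (x 0) := by
          rw [Subgroup.closure_le]
          rintro _ ⟨i, hi, rfl⟩
          rw [Set.mem_Iio] at hi
          obtain rfl : i = 0 := by omega
          exact Subgroup.mem_zpowers _
        rw [hx.closure_eq] at hle
        exact hle (Subgroup.mem_top g)
      by_cases h4 : 4 ≤ Nat.card G
      · exact Or.inl (admits_two_of_isCyclic h4)
      · obtain ⟨g, hg⟩ := hexp
        have hpos : 0 < Nat.card G := Nat.card_pos
        have hg' : g ^ Nat.card G = 1 := pow_card_eq_one'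
        obtain h | h | h : Nat.card G = 1 ∨ Nat.card G = 2 ∨ Nat.card G = 3 := by omega
        · rw [h, pow_one] at hg'
          simp [hg'] at hg
        · rw [h] at hg'
          exact absurd hg' hg
        · exact Or.inr (Or.inr (Or.inr (Or.inl (mulEquiv_zmod_three h))))
  · push Not at hexp
    let : CommGroup G :=
      { ‹Group G› with
        mul_comm := fun a b => by
          have h := fun g : G => inv_eq_of_mul_eq_one_left ((pow_two g).symm.trans (hexp g))
          rw [← h (a * b), mul_inv_rev, h, h] }
    rcases mulEquiv_or_four_le_rank hexp with h | h | h | h | h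
    · exact Or.inl (IrredundantGenerators.admits_two_of_exponent_two hx hexp h)
    · exact Or.inr (Or.inl h)
    · exact Or.inr (Or.inr (Or.inl h))
    · exact Or.inr (Or.inr (Or.inr (Or.inr (Or.inl h))))
    · exact Or.inr (Or.inr (Or.inr (Or.inr (Or.inr h))))

/-! ### One part -/

theorem eq_of_ne_of_card_le_two {α : Type*} [Finite α] (h : Nat.card α ≤ 2) {a b c : α}
    (hac : a ≠ c) (hbc : b ≠ c) : a = b := by
  classical
  have := Fintype.ofFinite α
  by_contra hab
  have h3 : ({a, b, c} : Finset α).card = 3 := Finset.card_eq_three.2 ⟨a, b, c, hab, hac, hbc, rfl⟩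
  have h4 := Finset.card_le_univ ({a, b, c} : Finset α)
  rw [← Nat.card_eq_fintype_card] at h4
  omega

/-- On at most two points a permutation is determined by one image, so the arcless digraph works. -/
theorem admits_one_of_card_le_two {G : Type u} [Group G] [Finite G] (h : Nat.card G ≤ 2) :
    AdmitsPartiteRepresentation.{u, v} G 1 := by
  have := admits_of_translations.{u, v} (G := G) (I := Unit) ⟨fun _ _ => False⟩
    ⟨0, fun x => by simp⟩ (by simp) ?_ (by simp)
  · simpa using this
  · intro σ _
    refine ⟨(σ (1, ())).1, ?_⟩
    rintro ⟨g, ⟨⟩⟩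
    refine Prod.ext ?_ rfl
    by_cases hg : g = 1
    · simp [hg]
    · refine eq_of_ne_of_card_le_two h (c := (σ (1, ())).1) ?_ (by simpa using hg)
      intro he
      have := σ.injective (Prod.ext he rfl : σ (g, ()) = σ (1, ()))
      exact hg (congrArg Prod.fst this)

/-! ### The trivial group: asymmetric regular digraphs -/

theorem admits_of_asymmetric {G : Type u} [Group G] [Finite G] [Subsingleton G] {n : ℕ}
    (hn : 0 < n) (Γ : Digraph (Fin n)) (hreg : Γ.IsRegular) (hloop : ∀ x, ¬ Γ.Adj x x)
    (haut : ∀ σ ∈ Γ.autGroup, σ = 1) : AdmitsPartiteRepresentation.{u, v} G n := by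
  have : Nonempty (Fin n) := ⟨⟨0, hn⟩⟩
  let : Unique G := uniqueOfSubsingleton 1
  let e : G × Fin n ≃ Fin n := Equiv.uniqueProd (Fin n) G
  have := admits_of_translations.{u, v} (G := G) _ (hreg.comap e) (fun t x y => Iff.rfl) ?_ ?_
  · simpa using this
  · intro σ hσ
    have h := haut ((e.symm.trans σ).trans e) fun x y => by
      simpa using hσ (e.symm x) (e.symm y)
    refine ⟨1, fun x => ?_⟩
    have hx := DFunLike.congr_fun h (e x)
    simp only [Equiv.trans_apply, Equiv.symm_apply_apply, Equiv.Perm.one_apply] at hx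
    rw [e.injective hx]
    simp
  · rintro ⟨g, i⟩ ⟨h, j⟩ hij
    obtain rfl : i = j := hij
    exact hloop i

/-- A regular digraph of valency two on six vertices without non-trivial automorphisms. -/
def sixDigraph : Digraph (Fin 6) :=
  ⟨fun i j => j ∈ (![{1, 2}, {0, 2}, {3, 4}, {4, 5}, {1, 5}, {0, 3}] : Fin 6 → Finset (Fin 6)) i⟩

instance : DecidableRel sixDigraph.Adj := fun _ _ =>
  inferInstanceAs (Decidable (_ ∈ (_ : Finset (Fin 6))))

theorem sixDigraph_isRegular : sixDigraph.IsRegular := by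
  refine ⟨2, fun x => ⟨?_, ?_⟩⟩
  · rw [Set.encard_eq_coe_toFinset_card, Nat.cast_inj]
    revert x
    decide
  · rw [Set.encard_eq_coe_toFinset_card, Nat.cast_inj]
    revert x
    decide

theorem sixDigraph_asymmetric : ∀ σ ∈ sixDigraph.autGroup, σ = 1 := by
  have key : ∀ σ : Equiv.Perm (Fin 6),
      (∀ x y, sixDigraph.Adj x y → sixDigraph.Adj (σ x) (σ y)) → σ = 1 := by
    decide +kernel
  exact fun σ hσ => key σ fun x y => (hσ x y).2

/-- A directed cycle on `k + 7` vertices together with backward directed cycles on the first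
`k + 4` and on the last three vertices. -/
def twoBlockDigraph (k : ℕ) : Digraph (Fin (k + 7)) :=
  ⟨fun i j => i.val + 1 = j.val ∨ (i.val = k + 6 ∧ j.val = 0) ∨
    (j.val + 1 = i.val ∧ i.val ≠ k + 4) ∨ (i.val = 0 ∧ j.val = k + 3) ∨
    (i.val = k + 4 ∧ j.val = k + 6)⟩

theorem twoBlockDigraph_isRegular (k : ℕ) : (twoBlockDigraph k).IsRegular := by
  have pair : ∀ (S : Set (Fin (k + 7))) (a b : ℕ) (ha : a < k + 7) (hb : b < k + 7), a ≠ b →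
      (∀ j : Fin (k + 7), j ∈ S ↔ j.val = a ∨ j.val = b) → S.encard = ((2 : ℕ) : ℕ∞) := by
    intro S a b ha hb hab h
    have : S = {⟨a, ha⟩, ⟨b, hb⟩} := by
      ext j
      simp [h, Fin.ext_iff]
    rw [this, Set.encard_pair (by simpa using hab)]
    rfl
  refine ⟨2, fun i => ?_⟩
  have hi := i.2
  constructor
  · refine pair _ (if i.val = k + 6 then 0 else i.val + 1)
      (if i.val = 0 then k + 3 else if i.val = k + 4 then k + 6 else i.val - 1)
      (by split_ifs <;> omega) (by split_ifs <;> omega) (by split_ifs <;> omega) fun j => ?_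
    have hj := j.2
    simp only [twoBlockDigraph, Set.mem_ofPred_eq]
    split_ifs <;> omega
  · refine pair _ (if i.val = 0 then k + 6 else i.val - 1)
      (if i.val = k + 3 then 0 else if i.val = k + 6 then k + 4 else i.val + 1)
      (by split_ifs <;> omega) (by split_ifs <;> omega) (by split_ifs <;> omega) fun j => ?_
    have hj := j.2
    simp only [twoBlockDigraph, Set.mem_ofPred_eq]
    split_ifs <;> omega

theorem twoBlockDigraph_bidirected {k : ℕ} (i j : Fin (k + 7)) :
    (twoBlockDigraph k).Bidirected i j ↔
      (i.val + 1 = j.val ∧ j.val ≠ k + 4) ∨ (j.val + 1 = i.val ∧ i.val ≠ k + 4) := by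
  have hi := i.2
  have hj := j.2
  simp only [Digraph.Bidirected, twoBlockDigraph]
  omega

/-- The bidirected edges form the paths 0, …, k + 3 and k + 4, k + 5, k + 6. Only k + 4 has an arc
to a vertex two bidirected edges away, because the first block has at least four vertices. Hence the
short path is fixed; the arc from k + 6 to 0 fixes 0, and then the long path is fixed. -/
theorem twoBlockDigraph_asymmetric {k : ℕ} : ∀ σ ∈ (twoBlockDigraph k).autGroup, σ = 1 := by
  intro σ hσ
  have htri : ∀ i : Fin (k + 7), (∃ y z, (twoBlockDigraph k).Bidirected i y ∧
      (twoBlockDigraph k).Bidirected y z ∧ (twoBlockDigraph k).Adj i z) → i.val = k + 4 := by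
    rintro i ⟨y, z, h1, h2, h3⟩
    rw [twoBlockDigraph_bidirected] at h1 h2
    simp only [twoBlockDigraph] at h3
    have := i.2
    have := y.2
    have := z.2
    omega
  have fix : ∀ t (ht : t < k + 7), (σ ⟨t, ht⟩).val = t → σ ⟨t, ht⟩ = ⟨t, ht⟩ :=
    fun t ht h => Fin.ext h
  have inj : ∀ s t (hs : s < k + 7) (ht : t < k + 7), s ≠ t → σ ⟨s, hs⟩ = ⟨s, hs⟩ →
      (σ ⟨t, ht⟩).val ≠ s := by
    intro s t hs ht hst h he
    have := σ.injective ((Fin.ext he : σ ⟨t, ht⟩ = ⟨s, hs⟩).trans h.symm)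
    rw [Fin.mk.injEq] at this
    exact hst this.symm
  have bid : ∀ s t (hs : s < k + 7) (ht : t < k + 7), σ ⟨s, hs⟩ = ⟨s, hs⟩ →
      (s + 1 = t ∧ t ≠ k + 4) ∨ (t + 1 = s ∧ s ≠ k + 4) →
      (s + 1 = (σ ⟨t, ht⟩).val ∧ (σ ⟨t, ht⟩).val ≠ k + 4) ∨
        ((σ ⟨t, ht⟩).val + 1 = s ∧ s ≠ k + 4) := by
    intro s t hs ht h hst
    have := (Digraph.bidirected_map hσ ⟨s, hs⟩ ⟨t, ht⟩).2
      ((twoBlockDigraph_bidirected _ _).2 hst)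
    rwa [h, twoBlockDigraph_bidirected] at this
  have f4 : σ ⟨k + 4, by omega⟩ = ⟨k + 4, by omega⟩ := by
    refine fix _ _ (htri _ ⟨σ ⟨k + 5, by omega⟩, σ ⟨k + 6, by omega⟩, ?_, ?_, ?_⟩)
    · rw [Digraph.bidirected_map hσ, twoBlockDigraph_bidirected]
      simp
    · rw [Digraph.bidirected_map hσ, twoBlockDigraph_bidirected]
      simp
    · rw [hσ]
      simp [twoBlockDigraph]
  have f5 : σ ⟨k + 5, by omega⟩ = ⟨k + 5, by omega⟩ := by
    refine fix _ _ ?_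
    have := bid (k + 4) (k + 5) (by omega) (by omega) f4 (by omega)
    omega
  have f6 : σ ⟨k + 6, by omega⟩ = ⟨k + 6, by omega⟩ := by
    refine fix _ _ ?_
    have := bid (k + 5) (k + 6) (by omega) (by omega) f5 (by omega)
    have := inj (k + 4) (k + 6) (by omega) (by omega) (by omega) f4
    omega
  have f0 : σ ⟨0, by omega⟩ = ⟨0, by omega⟩ := by
    refine fix _ _ ?_
    have h1 := (hσ ⟨k + 6, by omega⟩ ⟨0, by omega⟩).2 (Or.inr (Or.inl ⟨rfl, rfl⟩))
    rw [f6] at h1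
    have := inj (k + 5) 0 (by omega) (by omega) (by omega) f5
    have := (σ ⟨0, by omega⟩).2
    simp only [twoBlockDigraph] at h1
    omega
  have hall : ∀ t (ht : t < k + 4), σ ⟨t, by omega⟩ = ⟨t, by omega⟩ := by
    intro t
    induction t using Nat.strong_induction_on with
    | _ t ih =>
      intro ht
      cases t with
      | zero => exact f0
      | succ t =>
        refine fix _ _ ?_
        have h1 := bid t (t + 1) (by omega) (by omega) (ih t (by omega) (by omega)) (by omega)
        cases t with
        | zero => omega
        | succ t =>
          have := inj t (t + 1 + 1) (by omega) (by omega) (by omega) (ih t (by omega) (by omega))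
          omega
  ext i
  have hi := i.2
  obtain h | h | h | h : i.val < k + 4 ∨ i.val = k + 4 ∨ i.val = k + 5 ∨ i.val = k + 6 := by omega
  · rw [hall i.val h]; rfl
  · rw [show i = ⟨k + 4, by omega⟩ from Fin.ext h, f4]; rfl
  · rw [show i = ⟨k + 5, by omega⟩ from Fin.ext h, f5]; rfl
  · rw [show i = ⟨k + 6, by omega⟩ from Fin.ext h, f6]; rfl

theorem admits_of_six_le {G : Type u} [Group G] [Finite G] [Subsingleton G] {n : ℕ}
    (hn : 6 ≤ n) : AdmitsPartiteRepresentation.{u, v} G n := by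
  rcases hn.eq_or_lt with rfl | hn
  · exact admits_of_asymmetric (by omega) sixDigraph sixDigraph_isRegular (by decide)
      sixDigraph_asymmetric
  · obtain ⟨k, rfl⟩ := Nat.exists_eq_add_of_le' (Nat.succ_le_of_lt hn)
    refine admits_of_asymmetric (by omega) (twoBlockDigraph k) (twoBlockDigraph_isRegular k) ?_
      twoBlockDigraph_asymmetric
    intro x
    have := x.2
    simp only [twoBlockDigraph]
    omega

/-! ### Asymmetric regular digraphs need six vertices -/

/-- The loopless complement of a digraph. -/
def Digraph.looplessCompl {V : Type*} (Γ : Digraph V) : Digraph V :=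
  ⟨fun x y => x ≠ y ∧ ¬ Γ.Adj x y⟩

theorem Digraph.autGroup_looplessCompl {V : Type*} {Γ : Digraph V} (hloop : ∀ x, ¬ Γ.Adj x x) :
    Γ.looplessCompl.autGroup = Γ.autGroup := by
  ext σ
  refine forall₂_congr fun x y => ?_
  rcases eq_or_ne x y with rfl | hxy
  · simp [looplessCompl, hloop]
  · simp [looplessCompl, hxy, not_iff_not]

theorem Set.encard_compl_insert {n d : ℕ} {S : Set (Fin n)} (hS : S.encard = d) {x : Fin n}
    (hx : x ∉ S) : {y | y ≠ x ∧ y ∉ S}.encard = (n - 1 - d : ℕ) := by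
  have h1 : (insert x S).encard = (d + 1 : ℕ) := by
    rw [Set.encard_insert_of_notMem hx, hS]
    rfl
  have h2 := Set.encard_add_encard_compl (insert x S)
  have h3 : (insert x S)ᶜ = {y | y ≠ x ∧ y ∉ S} := by
    ext y
    simp
  rw [h3, h1, Set.encard_univ, ENat.card_eq_coe_natCard, Nat.card_fin,
    (Set.toFinite _).encard_eq_coe_toFinset_card] at h2
  rw [(Set.toFinite _).encard_eq_coe_toFinset_card]
  norm_cast at h2 ⊢
  omega

/-- The search for a non-trivial automorphism of a digraph on five vertices. -/
def existsAut (A : ℕ → ℕ → Bool) : Bool :=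
  (List.range 5).any fun p => (List.range 5).any fun q =>
    p != q && A p q == A 0 1 && A q p == A 1 0 && (List.range 5).any fun r =>
      r != p && r != q && A p r == A 0 2 && A q r == A 1 2 && A r p == A 2 0 && A r q == A 2 1 &&
        (List.range 5).any fun s =>
          s != p && s != q && s != r && A p s == A 0 3 && A q s == A 1 3 && A r s == A 2 3 &&
            A s p == A 3 0 && A s q == A 3 1 && A s r == A 3 2 && (List.range 5).any fun t =>
              t != p && t != q && t != r && t != s && A p t == A 0 4 && A q t == A 1 4 &&
                A r t == A 2 4 && A s t == A 3 4 && A t p == A 4 0 && A t q == A 4 1 &&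
                A t r == A 4 2 && A t s == A 4 3 && (p != 0 || q != 1 || r != 2 || s != 3)

/-- The number of binary digits `1` of `s` among the first `n`. -/
def bitCount (n s : ℕ) : ℕ := ((List.range n).filter fun c => s.testBit c).length

/-- The possible out-neighbourhoods of `i`, as bit masks. -/
def pairMasks (i : ℕ) : List ℕ :=
  (List.range 32).filter fun s => bitCount 5 s == 2 && !s.testBit i

/-- Exhaustion over the out-neighbourhoods of the five vertices. The test after three rows discards
early the cases where a vertex already has three in-neighbours. -/
theorem existsAut_of_masks :
    ((pairMasks 0).all fun a => (pairMasks 1).all fun b => (pairMasks 2).all fun c =>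
      !((List.range 5).all fun j => !(a.testBit j && b.testBit j && c.testBit j)) ||
      (pairMasks 3).all fun d => (pairMasks 4).all fun e =>
        !((List.range 5).all fun j => (a.testBit j).toNat + (b.testBit j).toNat +
          (c.testBit j).toNat + (d.testBit j).toNat + (e.testBit j).toNat == 2) ||
        existsAut fun i j => ([a, b, c, d, e].getD i 0).testBit j) = true := by
  decide +kernel

theorem bitCount_eq_card (n s : ℕ) :
    bitCount n s = (Finset.univ.filter fun i : Fin n => s.testBit i = true).card := by
  have : bitCount n s = ((Finset.range n).filter fun i => s.testBit i = true).card := by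
    rw [bitCount]
    change _ = Multiset.card (Multiset.filter _ (List.range n : Multiset ℕ))
    simp
  rw [this, Finset.card_filter, Finset.card_filter, Finset.sum_range]

theorem existsAut_sound {A : ℕ → ℕ → Bool} (hdiag : ∀ i : Fin 5, A i i = false)
    (h : existsAut A = true) :
    ∃ σ : Equiv.Perm (Fin 5), σ ≠ 1 ∧ ∀ i j : Fin 5, A (σ i) (σ j) = A i j := by
  simp only [existsAut, List.any_eq_true, List.mem_range, Bool.and_eq_true, Bool.or_eq_true,
    bne_iff_ne, beq_iff_eq] at h
  obtain ⟨p, hp, q, hq, ⟨⟨hqp, a1⟩, a2⟩, r, hr, ⟨⟨⟨⟨⟨hrp, hrq⟩, a3⟩, a4⟩, a5⟩, a6⟩, s, hs,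
    ⟨⟨⟨⟨⟨⟨⟨⟨hsp, hsq⟩, hsr⟩, a7⟩, a8⟩, a9⟩, a10⟩, a11⟩, a12⟩, t, ht,
    ⟨⟨⟨⟨⟨⟨⟨⟨⟨⟨⟨htp, htq⟩, htr⟩, hts⟩, a13⟩, a14⟩, a15⟩, a16⟩, a17⟩, a18⟩, a19⟩, a20⟩, hne⟩ := h
  let f : Fin 5 → Fin 5 := ![⟨p, hp⟩, ⟨q, hq⟩, ⟨r, hr⟩, ⟨s, hs⟩, ⟨t, ht⟩]
  have hinj : Function.Injective f := by
    intro i j hij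
    have hij' := congrArg Fin.val hij
    fin_cases i <;> fin_cases j <;> simp [f] at hij' ⊢ <;> omega
  refine ⟨Equiv.ofBijective f (Finite.injective_iff_bijective.1 hinj), ?_, ?_⟩
  · intro h1
    have hf : ∀ i, f i = i := fun i => DFunLike.congr_fun h1 i
    have e0 := congrArg Fin.val (hf 0)
    have e1 := congrArg Fin.val (hf 1)
    have e2 := congrArg Fin.val (hf 2)
    have e3 := congrArg Fin.val (hf 3)
    simp [f] at e0 e1 e2 e3
    omega
  · intro i j
    change A (f i) (f j) = A i j
    rcases eq_or_ne i j with rfl | hij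
    · rw [hdiag, hdiag]
    · fin_cases i <;> fin_cases j <;> first
        | exact absurd rfl hij
        | assumption

theorem exists_aut_ne_one_five {Γ : Digraph (Fin 5)} (hloop : ∀ x, ¬ Γ.Adj x x)
    (hout : ∀ x, {y | Γ.Adj x y}.encard = 2) (hin : ∀ x, {y | Γ.Adj y x}.encard = 2) :
    ∃ σ ∈ Γ.autGroup, σ ≠ 1 := by
  classical
  let r : Fin 5 → ℕ := fun i => Nat.ofBits fun j => decide (Γ.Adj i j)
  have hr : ∀ i j : Fin 5, (r i).testBit j = decide (Γ.Adj i j) := fun i j => by simp [r]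
  have hpair : ∀ i : Fin 5, r i ∈ pairMasks i := by
    intro i
    simp only [pairMasks, List.mem_filter, List.mem_range, Bool.and_eq_true, beq_iff_eq,
      Bool.not_eq_true', hr]
    refine ⟨Nat.ofBits_lt_two_pow _, ?_, by simp [hloop]⟩
    have := hout i
    rw [Set.encard_eq_coe_toFinset_card] at this
    rw [bitCount_eq_card]
    simp only [hr, decide_eq_true_eq]
    have h2 : ({y | Γ.Adj i y} : Set (Fin 5)).toFinset.card = 2 := by exact_mod_cast this
    rw [← h2]
    congr 1
    ext j
    simp
  have hcol : ∀ j : Fin 5, ((r 0).testBit j).toNat + ((r 1).testBit j).toNat +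
      ((r 2).testBit j).toNat + ((r 3).testBit j).toNat + ((r 4).testBit j).toNat = 2 := by
    intro j
    have := hin j
    rw [Set.encard_eq_coe_toFinset_card] at this
    have h2 : ({y | Γ.Adj y j} : Set (Fin 5)).toFinset.card = 2 := by exact_mod_cast this
    have h3 : ({y | Γ.Adj y j} : Set (Fin 5)).toFinset = Finset.univ.filter fun i => Γ.Adj i j := by
      ext
      simp
    rw [h3, Finset.card_filter, Fin.sum_univ_five] at h2
    simp only [hr]
    rw [← h2]
    simp only [Bool.toNat, Bool.cond_decide]
  have hcol' : ∀ j < 5, ((r 0).testBit j).toNat + ((r 1).testBit j).toNat +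
      ((r 2).testBit j).toNat + ((r 3).testBit j).toNat + ((r 4).testBit j).toNat = 2 :=
    fun j hj => hcol ⟨j, hj⟩
  have hA : ∀ i j : Fin 5, ([r 0, r 1, r 2, r 3, r 4].getD i 0).testBit j =
      decide (Γ.Adj i j) := by
    intro i j
    rw [← hr]
    fin_cases i <;> rfl
  have h := existsAut_of_masks
  simp only [List.all_eq_true, Bool.or_eq_true, Bool.not_eq_true', List.all_eq_false,
    List.mem_range, beq_iff_eq] at h
  have h1 := h (r 0) (hpair 0) (r 1) (hpair 1) (r 2) (hpair 2)
  rcases h1 with ⟨j, hj, h1⟩ | h1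
  · exfalso
    have := hcol' j hj
    simp at h1
    simp [h1] at this
    omega
  · rcases h1 (r 3) (hpair 3) (r 4) (hpair 4) with ⟨j, hj, h2⟩ | h2
    · exact absurd (hcol' j hj) h2
    · obtain ⟨σ, hσ, hσA⟩ := existsAut_sound (fun i => by rw [hA]; simp [hloop]) h2
      refine ⟨σ, fun i j => ?_, hσ⟩
      have := hσA i j
      rwa [hA, hA, decide_eq_decide] at this

/-- Without arcs any transposition works. In valency one the arcs are the graph of a
fixed-point-free permutation, which is itself an automorphism. -/
theorem Digraph.exists_aut_ne_one_of_encard_le_one {n : ℕ} (hn : 2 ≤ n) {Γ : Digraph (Fin n)}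
    (hloop : ∀ x, ¬ Γ.Adj x x) {d : ℕ} (hd : d ≤ 1)
    (hreg : ∀ x, {y | Γ.Adj x y}.encard = d ∧ {y | Γ.Adj y x}.encard = d) :
    ∃ σ ∈ Γ.autGroup, σ ≠ 1 := by
  obtain rfl | rfl : d = 0 ∨ d = 1 := by omega
  · have hno : ∀ x y, ¬ Γ.Adj x y := fun x y h => by
      have := Set.encard_eq_zero.1 (hreg x).1
      exact Set.notMem_empty y (this ▸ h)
    refine ⟨Equiv.swap ⟨0, by omega⟩ ⟨1, by omega⟩, fun x y => by simp [hno], ?_⟩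
    rw [Ne, Equiv.Perm.one_def, Equiv.swap_eq_refl_iff]
    simp
  · have h1 : ∀ x, ∃ y, {z | Γ.Adj x z} = {y} := fun x => Set.encard_eq_one.1 (hreg x).1
    choose f hf using h1
    have hadj : ∀ x y, Γ.Adj x y ↔ y = f x := fun x y => by
      have : y ∈ {z | Γ.Adj x z} ↔ y ∈ ({f x} : Set (Fin n)) := by rw [hf]
      simpa using this
    have hinj : Function.Injective f := by
      intro x y hxy
      obtain ⟨z, hz⟩ := Set.encard_eq_one.1 (hreg (f x)).2
      have h1 : x ∈ {y | Γ.Adj y (f x)} := (hadj _ _).2 rfl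
      have h2 : y ∈ {y | Γ.Adj y (f x)} := (hadj _ _).2 hxy
      rw [hz, Set.mem_singleton_iff] at h1 h2
      rw [h1, h2]
    refine ⟨Equiv.ofBijective f (Finite.injective_iff_bijective.1 hinj), fun x y => ?_, fun h => ?_⟩
    · simp [hadj, hinj.eq_iff]
    · have h0 : f ⟨0, by omega⟩ = ⟨0, by omega⟩ := DFunLike.congr_fun h ⟨0, by omega⟩
      exact hloop _ ((hadj _ _).2 h0.symm)

/-- The loopless complement has the same automorphisms and valency n - 1 - d. For n ≤ 5 both
valencies exceed 1 only when n = 5 and d = 2. -/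
theorem Digraph.exists_aut_ne_one {n : ℕ} (hn : 2 ≤ n) (hn5 : n ≤ 5) {Γ : Digraph (Fin n)}
    (hloop : ∀ x, ¬ Γ.Adj x x) (hreg : Γ.IsRegular) : ∃ σ ∈ Γ.autGroup, σ ≠ 1 := by
  obtain ⟨d, hd⟩ := hreg
  by_cases hd1 : d ≤ 1
  · exact exists_aut_ne_one_of_encard_le_one hn hloop hd1 hd
  by_cases hd2 : n - 1 - d ≤ 1
  · rw [← autGroup_looplessCompl hloop]
    refine exists_aut_ne_one_of_encard_le_one hn (by simp [looplessCompl]) hd2 fun x => ?_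
    refine ⟨?_, Set.encard_compl_insert (hd x).2 (x := x) (hloop x)⟩
    rw [← Set.encard_compl_insert (hd x).1 (x := x) (hloop x)]
    simp [looplessCompl, ne_comm]
  · obtain ⟨rfl, rfl⟩ : n = 5 ∧ d = 2 := by omega
    exact exists_aut_ne_one_five hloop (fun x => (hd x).1) fun x => (hd x).2

/-! ### Nonexistence for one part and for the trivial group -/

namespace Digraph.IsPartiteRepresentation

theorem eq_one_of_fixed {V : Type v} {Γ : Digraph V} {G : Type u} [Group G] {n : ℕ}
    (h : Γ.IsPartiteRepresentation G n) {a : Γ.autGroup} {x : V} (hx : a • x = x) : a = 1 := by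
  have : a ∈ MulAction.stabilizer Γ.autGroup x := hx
  rwa [h.semiregular x, Subgroup.mem_bot] at this

theorem congr {V : Type v} {Γ : Digraph V} {G : Type*} {G' : Type*} [Group G] [Group G'] {n : ℕ}
    (h : Γ.IsPartiteRepresentation G n) (e : G ≃* G') : Γ.IsPartiteRepresentation G' n :=
  ⟨h.regular, h.aut_iso.map fun f => f.trans e, h.semiregular, h.card_orbits, h.orbit_empty⟩

end Digraph.IsPartiteRepresentation

/-- A single orbit forbids all arcs, so a transposition is an automorphism, and it fixes a third
point. -/
theorem not_admits_one {G : Type u} [Group G] [Finite G] (hG : 3 ≤ Nat.card G) :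
    ¬ AdmitsPartiteRepresentation.{u, v} G 1 := by
  classical
  rintro ⟨V, ⟨x⟩, Γ, h⟩
  obtain ⟨φ⟩ := h.aut_iso
  have hsub : Subsingleton (MulAction.orbitRel.Quotient Γ.autGroup V) :=
    ENat.card_le_one_iff_subsingleton _ |>.1 (by rw [h.card_orbits]; rfl)
  have hmem : ∀ y, y ∈ MulAction.orbit Γ.autGroup x := fun y =>
    MulAction.orbitRel_apply.1 (Quotient.exact (Subsingleton.elim
      (Quotient.mk (MulAction.orbitRel Γ.autGroup V) y) (Quotient.mk _ x)))
  have hno : ∀ y z, ¬ Γ.Adj y z := fun y z => h.orbit_empty x y (hmem y) z (hmem z)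
  have := Fintype.ofFinite G
  rw [Nat.card_eq_fintype_card] at hG
  obtain ⟨a, b, c, hab, hac, hbc⟩ := Fintype.two_lt_card_iff.1 (show 2 < Fintype.card G by omega)
  have hinj : ∀ s t : G, φ.symm s • x = φ.symm t • x → s = t := by
    intro s t hst
    have h1 : (φ.symm (t⁻¹ * s)) • x = x := by
      rw [map_mul, mul_smul, hst, ← mul_smul, ← map_mul]
      simp
    have h2 := h.eq_one_of_fixed h1
    rw [EmbeddingLike.map_eq_one_iff, inv_mul_eq_one] at h2
    exact h2.symm
  let σ : Γ.autGroup := ⟨Equiv.swap (φ.symm a • x) (φ.symm b • x), fun y z => by simp [hno]⟩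
  have hσ : σ • (φ.symm c • x) = φ.symm c • x :=
    Equiv.swap_apply_of_ne_of_ne (fun he => hac (hinj _ _ he).symm) fun he => hbc (hinj _ _ he).symm
  have h1 := congrArg Subtype.val (h.eq_one_of_fixed hσ)
  have h2 : Equiv.swap (φ.symm a • x) (φ.symm b • x) = Equiv.refl V := h1
  exact hab (hinj _ _ (Equiv.swap_eq_refl_iff.1 h2))

/-- The orbits are single points, so the digraph would be asymmetric on n vertices. -/
theorem not_admits_of_subsingleton {G : Type u} [Group G] [Subsingleton G] {n : ℕ} (hn : 2 ≤ n)
    (hn5 : n ≤ 5) : ¬ AdmitsPartiteRepresentation.{u, v} G n := by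
  rintro ⟨V, -, Γ, h⟩
  obtain ⟨φ⟩ := h.aut_iso
  have hsub : Subsingleton Γ.autGroup := φ.toEquiv.subsingleton
  let f : V → MulAction.orbitRel.Quotient Γ.autGroup V := Quotient.mk _
  have hf : Function.Bijective f := by
    refine ⟨fun x y hxy => ?_, Quotient.mk_surjective⟩
    obtain ⟨a, ha⟩ := MulAction.orbitRel_apply.1 (Quotient.exact hxy)
    rw [← ha, Subsingleton.elim a 1]
    exact one_smul _ y
  have hcard : ENat.card V = n := (ENat.card_congr (Equiv.ofBijective f hf)).trans h.card_orbits
  have hfin : Finite V := ENat.card_lt_top.1 (hcard ▸ ENat.natCast_lt_top n)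
  have hnat : Nat.card V = n := by
    rw [ENat.card_eq_coe_natCard] at hcard
    exact_mod_cast hcard
  let e : Fin n ≃ V := (Finite.equivFinOfCardEq hnat).symm
  obtain ⟨σ, hσ, hne⟩ := Digraph.exists_aut_ne_one hn hn5
    (Γ := ⟨fun x y => Γ.Adj (e x) (e y)⟩)
    (fun x => h.orbit_empty (e x) _ (MulAction.mem_orbit_self _) _ (MulAction.mem_orbit_self _))
    (h.regular.comap e)
  have hσ' : (e.symm.trans σ).trans e ∈ Γ.autGroup := fun x y => by
    simpa using hσ (e.symm x) (e.symm y)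
  have h1 := congrArg Subtype.val
    (Subsingleton.elim (⟨_, hσ'⟩ : Γ.autGroup) 1)
  refine hne (Equiv.ext fun i => e.injective ?_)
  simpa using DFunLike.congr_fun h1 (e i)

/-! ### Two parts: affine maps as obstructions -/

/-- The bipartite digraph on `G × Bool` with connection sets `S` and `T`. -/
def biDigraph {G : Type*} [Group G] (S T : Set G) : Digraph (G × Bool) :=
  ⟨fun x y => (x.2 = false ∧ y.2 = true ∧ x.1⁻¹ * y.1 ∈ S) ∨
    (x.2 = true ∧ y.2 = false ∧ x.1⁻¹ * y.1 ∈ T)⟩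

/-- A bipartite representation is given by two connection sets of the same size, all of whose
automorphisms are translations. -/
theorem AdmitsPartiteRepresentation.exists_biDigraph {G : Type u} [Group G]
    (h : AdmitsPartiteRepresentation.{u, v} G 2) :
    ∃ S T : Set G, S.encard = T.encard ∧
      ∀ σ ∈ (biDigraph S T).autGroup, ∃ t, ∀ x, σ x = (t * x.1, x.2) := by
  obtain ⟨V, ⟨b₀⟩, Γ, h⟩ := h
  obtain ⟨φ⟩ := h.aut_iso
  let A := Γ.autGroup
  let q : V → MulAction.orbitRel.Quotient A V := Quotient.mk _
  have hq : ∀ x y, q x = q y ↔ x ∈ MulAction.orbit A y := fun x y =>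
    ⟨fun hxy => MulAction.orbitRel_apply.1 (Quotient.exact hxy), fun hxy => Quotient.sound hxy⟩
  have hfin : Finite (MulAction.orbitRel.Quotient A V) :=
    ENat.card_lt_top.1 (h.card_orbits ▸ ENat.natCast_lt_top 2)
  have hcard : Nat.card (MulAction.orbitRel.Quotient A V) = 2 := by
    have := h.card_orbits
    rw [ENat.card_eq_coe_natCard] at this
    exact_mod_cast this
  obtain ⟨b₁, hb⟩ : ∃ b₁, q b₁ ≠ q b₀ := by
    by_contra! hall
    have : Subsingleton (MulAction.orbitRel.Quotient A V) :=
      ⟨fun x y => by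
        obtain ⟨x, rfl⟩ := Quotient.mk_surjective x
        obtain ⟨y, rfl⟩ := Quotient.mk_surjective y
        exact (hall x).trans (hall y).symm⟩
    have := Finite.card_le_one_iff_subsingleton.2 this
    omega
  have hcover : ∀ x, q x ≠ q b₀ → q x = q b₁ := fun x hx =>
    eq_of_ne_of_card_le_two hcard.le hx hb
  let b : Bool → V := fun i => bif i then b₁ else b₀
  -- A base point in each of the two orbits gives coordinates; semiregularity makes them unique.
  let f : G × Bool → V := fun x => φ.symm x.1 • b x.2
  have hqf : ∀ x, q (f x) = q (b x.2) := fun x => (hq _ _).2 ⟨_, rfl⟩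
  have hfinj : Function.Injective f := by
    rintro ⟨g, i⟩ ⟨g', j⟩ hxy
    have hij : q (b i) = q (b j) := by rw [← hqf (g, i), ← hqf (g', j), hxy]
    obtain rfl : i = j := by
      cases i <;> cases j
      · rfl
      · exact absurd hij.symm hb
      · exact absurd hij hb
      · rfl
    have hxy' : φ.symm g • b i = φ.symm g' • b i := hxy
    have h1 : φ.symm (g'⁻¹ * g) • b i = b i := by
      rw [map_mul, mul_smul, hxy', ← mul_smul, ← map_mul]
      simp
    have h2 := h.eq_one_of_fixed h1
    rw [EmbeddingLike.map_eq_one_iff, inv_mul_eq_one] at h2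
    rw [h2]
  have hfsurj : Function.Surjective f := by
    intro x
    by_cases hx : q x = q b₀
    · obtain ⟨a, ha⟩ := (hq _ _).1 hx
      exact ⟨(φ a, false), by simpa [f, b] using ha⟩
    · obtain ⟨a, ha⟩ := (hq _ _).1 (hcover x hx)
      exact ⟨(φ a, true), by simpa [f, b] using ha⟩
  have htrans : ∀ (a : A) x y, Γ.Adj (a • x) (a • y) ↔ Γ.Adj x y := fun a x y => a.2 x y
  have hadj : ∀ i j g g', Γ.Adj (f (g, i)) (f (g', j)) ↔ Γ.Adj (b i) (f (g⁻¹ * g', j)) := by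
    intro i j g g'
    rw [← htrans (φ.symm g) (b i)]
    simp only [f, ← mul_smul, ← map_mul, mul_inv_cancel_left]
  have hempty : ∀ i g, ¬ Γ.Adj (b i) (f (g, i)) := fun i g =>
    h.orbit_empty (b i) _ (MulAction.mem_orbit_self _) _ ⟨_, rfl⟩
  let S : Set G := {g | Γ.Adj b₀ (f (g, true))}
  let T : Set G := {g | Γ.Adj b₁ (f (g, false))}
  have hf' : ∀ x y, Γ.Adj (f x) (f y) ↔ (biDigraph S T).Adj x y := by
    rintro ⟨g, i⟩ ⟨g', j⟩
    rw [hadj]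
    cases i <;> cases j
    · exact iff_of_false (hempty false _) (by simp [biDigraph])
    · simp [biDigraph, S, b]
    · simp [biDigraph, T, b]
    · exact iff_of_false (hempty true _) (by simp [biDigraph])
  -- All arcs leave the orbit, so both connection sets have size equal to the valency.
  have hout : ∀ i, {g | Γ.Adj (b i) (f (g, !i))}.encard = {y | Γ.Adj (b i) y}.encard := by
    intro i
    have : {y | Γ.Adj (b i) y} = (fun g => f (g, !i)) '' {g | Γ.Adj (b i) (f (g, !i))} := by
      ext y
      constructor
      · intro hy
        obtain ⟨⟨g, j⟩, rfl⟩ := hfsurj y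
        by_cases hij : j = i
        · subst hij
          exact absurd hy (hempty _ _)
        · obtain rfl : j = !i := by cases i <;> cases j <;> simp_all
          exact ⟨g, hy, rfl⟩
      · rintro ⟨g, hg, rfl⟩
        exact hg
    rw [this, Function.Injective.encard_image]
    intro g g' hgg
    exact congrArg Prod.fst (hfinj hgg)
  obtain ⟨d, hd⟩ := h.regular
  refine ⟨S, T, ?_, ?_⟩
  · exact ((hout false).trans (hd b₀).1).trans ((hout true).trans (hd b₁).1).symm
  · intro σ hσ
    let e := Equiv.ofBijective f ⟨hfinj, hfsurj⟩
    have he : ∀ x, f (e.symm x) = x := e.apply_symm_apply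
    have hmem : (e.symm.trans σ).trans e ∈ Γ.autGroup := fun x y => by
      change Γ.Adj (f (σ (e.symm x))) (f (σ (e.symm y))) ↔ _
      rw [hf', hσ, ← hf', he, he]
    refine ⟨φ ⟨_, hmem⟩, ?_⟩
    rintro ⟨g, i⟩
    apply hfinj
    have h1 : f (σ (g, i)) = ((e.symm.trans σ).trans e) (f (g, i)) := by
      change _ = f (σ (e.symm (e (g, i))))
      rw [Equiv.symm_apply_apply]
    rw [h1]
    change _ = φ.symm (φ ⟨_, hmem⟩ * g) • b i
    rw [map_mul, mul_smul, MulEquiv.symm_apply_apply]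
    rfl

/-- Every pair of equal-sized subsets of the abelian group `G` is preserved by a non-trivial affine
map, or interchanged by an affine map, where translations act oppositely on the two subsets. -/
def HasAffineSymmetries (G : Type*) [CommGroup G] : Prop :=
  ∀ S T : Set G, S.encard = T.encard → ∃ (α : G ≃* G) (b : G),
    (((∃ c, α c ≠ c) ∨ b ≠ 1) ∧ (∀ c, α c * b ∈ S ↔ c ∈ S) ∧ ∀ c, α c * b⁻¹ ∈ T ↔ c ∈ T) ∨
    ((∀ c, α c * b ∈ T ↔ c ∈ S) ∧ ∀ c, α c * b⁻¹ ∈ S ↔ c ∈ T)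

/-- Apply α on both levels and multiply by b on the level `true`: differences change by b in one
direction and by b⁻¹ in the other. If the pair is preserved, the result is a translation only for
trivial α and b; if it is interchanged, composing with the level flip gives an automorphism that
moves the levels. -/
theorem HasAffineSymmetries.not_admits_two {H : Type*} [CommGroup H]
    (hH : HasAffineSymmetries H) {G : Type u} [Group G] (e : G ≃* H) :
    ¬ AdmitsPartiteRepresentation.{u, v} G 2 := by
  rintro ⟨V, hV, Γ, h⟩
  obtain ⟨S, T, hcard, hrigid⟩ := AdmitsPartiteRepresentation.exists_biDigraph
    ⟨V, hV, Γ, h.congr e⟩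
  obtain ⟨α, b, ⟨hne, hS, hT⟩ | ⟨hS, hT⟩⟩ := hH S T hcard
  · let σ : Equiv.Perm (H × Bool) :=
      { toFun := fun x => (α x.1 * bif x.2 then b else 1, x.2)
        invFun := fun x => (α.symm (x.1 * (bif x.2 then b else 1)⁻¹), x.2)
        left_inv := fun x => by simp
        right_inv := fun x => by simp }
    have hσ : σ ∈ (biDigraph S T).autGroup := by
      rintro ⟨g, i⟩ ⟨g', j⟩
      cases i <;> cases j
      · simp [biDigraph, σ]
      · simpa [biDigraph, σ, mul_assoc] using hS (g⁻¹ * g')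
      · simpa [biDigraph, σ, mul_assoc, mul_comm, mul_left_comm] using hT (g⁻¹ * g')
      · simp [biDigraph, σ]
    obtain ⟨t, ht⟩ := hrigid σ hσ
    have h0 : ∀ c, α c = t * c := fun c => by simpa [σ] using congrArg Prod.fst (ht (c, false))
    have ht1 : t = 1 := by simpa using (h0 1).symm
    subst ht1
    have hb : b = 1 := by simpa [σ] using congrArg Prod.fst (ht (1, true))
    rcases hne with ⟨c, hc⟩ | hne
    · exact hc (by simpa using h0 c)
    · exact hne hb
  · let σ : Equiv.Perm (H × Bool) :=
      { toFun := fun x => (α x.1 * bif x.2 then b else 1, !x.2)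
        invFun := fun x => (α.symm (x.1 * (bif x.2 then 1 else b)⁻¹), !x.2)
        left_inv := fun x => by rcases x with ⟨x, _ | _⟩ <;> simp
        right_inv := fun x => by rcases x with ⟨x, _ | _⟩ <;> simp }
    have hσ : σ ∈ (biDigraph S T).autGroup := by
      rintro ⟨g, i⟩ ⟨g', j⟩
      cases i <;> cases j
      · simp [biDigraph, σ]
      · simpa [biDigraph, σ, mul_assoc] using hS (g⁻¹ * g')
      · simpa [biDigraph, σ, mul_assoc, mul_comm, mul_left_comm] using hT (g⁻¹ * g')
      · simp [biDigraph, σ]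
    obtain ⟨t, ht⟩ := hrigid σ hσ
    simpa [σ] using congrArg Prod.snd (ht (1, false))

/-! ### Affine symmetries in the small exceptional groups -/

theorem hasAffineSymmetries_multiplicative {M : Type*} [AddCommGroup M] [Fintype M]
    [DecidableEq M] (h : ∀ S T : Finset M, S.card = T.card → ∃ (α : M ≃+ M) (b : M),
      (((∃ c, α c ≠ c) ∨ b ≠ 0) ∧ (∀ c, α c + b ∈ S ↔ c ∈ S) ∧ ∀ c, α c - b ∈ T ↔ c ∈ T) ∨
      ((∀ c, α c + b ∈ T ↔ c ∈ S) ∧ ∀ c, α c - b ∈ S ↔ c ∈ T)) :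
    HasAffineSymmetries (Multiplicative M) := by
  classical
  intro S T hST
  let S' : Set M := Multiplicative.ofAdd ⁻¹' S
  let T' : Set M := Multiplicative.ofAdd ⁻¹' T
  have hcard : S'.toFinset.card = T'.toFinset.card := by
    have hS : S'.encard = S.encard :=
      Set.encard_preimage_of_bijective (f := Multiplicative.ofAdd) Multiplicative.ofAdd.bijective _
    have hT : T'.encard = T.encard :=
      Set.encard_preimage_of_bijective (f := Multiplicative.ofAdd) Multiplicative.ofAdd.bijective _
    rw [← hS, ← hT, Set.encard_eq_coe_toFinset_card, Set.encard_eq_coe_toFinset_card] at hST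
    exact_mod_cast hST
  obtain ⟨α, b, hα⟩ := h _ _ hcard
  simp only [Set.mem_toFinset, sub_eq_add_neg] at hα
  exact ⟨AddEquiv.toMultiplicative α, Multiplicative.ofAdd b, hα⟩

/-- Here, and for order three, the maps with identity linear part already suffice. -/
theorem hasAffineSymmetries_zmod_two : HasAffineSymmetries (Multiplicative (ZMod 2)) := by
  refine hasAffineSymmetries_multiplicative fun S T h => ⟨AddEquiv.refl _, ?_⟩
  revert S T
  decide

theorem hasAffineSymmetries_zmod_three : HasAffineSymmetries (Multiplicative (ZMod 3)) := by
  refine hasAffineSymmetries_multiplicative fun S T h => ⟨AddEquiv.refl _, ?_⟩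
  revert S T
  decide +kernel

set_option synthInstance.maxHeartbeats 400000 in
set_option synthInstance.maxSize 1000 in
theorem hasAffineSymmetries_zmod_two_sq :
    HasAffineSymmetries (Multiplicative (ZMod 2 × ZMod 2)) := by
  refine hasAffineSymmetries_multiplicative ?_
  -- Linear maps are encoded by their columns `x`, `y`, which makes the search finite and decidable.
  have key : ∀ S T : Finset (ZMod 2 × ZMod 2), S.card = T.card → ∃ x y b : ZMod 2 × ZMod 2,
      (∀ c : ZMod 2 × ZMod 2, c.1 • x + c.2 • y = 0 → c = 0) ∧
      ((((∃ c : ZMod 2 × ZMod 2, c.1 • x + c.2 • y ≠ c) ∨ b ≠ 0) ∧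
        (∀ c : ZMod 2 × ZMod 2, c.1 • x + c.2 • y + b ∈ S ↔ c ∈ S) ∧
        ∀ c : ZMod 2 × ZMod 2, c.1 • x + c.2 • y - b ∈ T ↔ c ∈ T) ∨
      ((∀ c : ZMod 2 × ZMod 2, c.1 • x + c.2 • y + b ∈ T ↔ c ∈ S) ∧
        ∀ c : ZMod 2 × ZMod 2, c.1 • x + c.2 • y - b ∈ S ↔ c ∈ T)) := by
    decide +kernel
  intro S T h
  obtain ⟨x, y, b, hinj, hxy⟩ := key S T h
  let α : ZMod 2 × ZMod 2 →+ ZMod 2 × ZMod 2 :=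
    { toFun := fun c => c.1 • x + c.2 • y
      map_zero' := by simp
      map_add' := fun c d => by simp only [Prod.fst_add, Prod.snd_add, add_smul]; abel }
  exact ⟨AddEquiv.ofBijective α (Finite.injective_iff_bijective.1
    ((injective_iff_map_eq_zero α).2 hinj)), b, hxy⟩

/-! ### Affine symmetries of the binary cube -/

/-- The image of `c` under the affine map of the binary cube with columns `x, y, z` and constant
term `t`, all in binary notation. -/
def affineBits (x y z t c : ℕ) : ℕ :=
  t ^^^ (bif c.testBit 0 then x else 0) ^^^ (bif c.testBit 1 then y else 0) ^^^
    (bif c.testBit 2 then z else 0)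

/-- Linear independence of three vectors of the binary cube in binary notation. -/
def independentBits (x y z : ℕ) : Bool :=
  x != 0 && y != 0 && y != x && z != 0 && z != x && z != y && z != x ^^^ y

/-- Search for an affine permutation of the binary cube whose graph satisfies `Q`. -/
def existsAffine (Q : ℕ → ℕ → Bool) (ok : ℕ → ℕ → ℕ → ℕ → Bool) : Bool :=
  (List.range 8).any fun t => Q 0 t && (List.range 8).any fun x =>
    Q 1 (t ^^^ x) && (List.range 8).any fun y =>
      y != x && Q 2 (t ^^^ y) && Q 3 (t ^^^ x ^^^ y) && (List.range 8).any fun z =>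
        independentBits x y z && Q 4 (t ^^^ z) && Q 5 (t ^^^ x ^^^ z) &&
          Q 6 (t ^^^ y ^^^ z) && Q 7 (t ^^^ x ^^^ y ^^^ z) && ok x y z t

theorem existsAffine_sound {Q : ℕ → ℕ → Bool} {ok : ℕ → ℕ → ℕ → ℕ → Bool}
    (h : existsAffine Q ok = true) :
    ∃ x < 8, ∃ y < 8, ∃ z < 8, ∃ t < 8, independentBits x y z = true ∧ ok x y z t = true ∧
      ∀ c < 8, Q c (affineBits x y z t c) = true := by
  simp only [existsAffine, List.any_eq_true, List.mem_range, Bool.and_eq_true] at h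
  obtain ⟨t, ht, q0, x, hx, q1, y, hy, ⟨⟨-, q2⟩, q3⟩, z, hz, ⟨⟨⟨⟨hind, q4⟩, q5⟩, q6⟩, q7⟩, hok⟩ := h
  refine ⟨x, hx, y, hy, z, hz, t, ht, hind, hok, fun c hc => ?_⟩
  interval_cases c <;> simpa [affineBits, Nat.testBit]

/-- Subsets of the binary cube up to affine equivalence, as bit masks. -/
def cubeSubsets : List ℕ := [0, 1, 3, 7, 15, 23, 31, 63, 127, 255]

/-- Moving the first set to one of ten representatives leaves far fewer pairs to search. -/
theorem existsAffine_to_cubeSubsets : ((List.range 256).all fun s => cubeSubsets.any fun r =>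
    bitCount 8 r == bitCount 8 s &&
      existsAffine (fun c d => r.testBit d == s.testBit c) fun _ _ _ _ => true) = true := by
  decide +kernel

theorem existsAffine_of_cubeSubsets : (cubeSubsets.all fun s => (List.range 256).all fun t =>
    bitCount 8 s != bitCount 8 t ||
    existsAffine (fun c d => s.testBit d == s.testBit c && t.testBit d == t.testBit c)
      (fun x y z t => x != 1 || y != 2 || z != 4 || t != 0) ||
    existsAffine (fun c d => t.testBit d == s.testBit c && s.testBit d == t.testBit c)
      (fun _ _ _ _ => true)) = true := by
  decide +kernel

/-- The vector of the binary cube with given binary notation. -/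
def cubeVector (n : ℕ) : ZMod 2 × ZMod 2 × ZMod 2 :=
  (bif n.testBit 0 then 1 else 0, bif n.testBit 1 then 1 else 0, bif n.testBit 2 then 1 else 0)

theorem cubeVector_xor (m n : ℕ) : cubeVector (m ^^^ n) = cubeVector m + cubeVector n := by
  have h : ∀ a b : Bool, (bif a ^^ b then (1 : ZMod 2) else 0) =
      (bif a then 1 else 0) + bif b then 1 else 0 := by decide
  simp only [cubeVector, Nat.testBit_xor, h, Prod.mk_add_mk]

theorem cubeVector_injOn : ∀ m < 8, ∀ n < 8, cubeVector m = cubeVector n → m = n := by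
  decide

theorem exists_cubeVector : ∀ c : ZMod 2 × ZMod 2 × ZMod 2, ∃ n < 8, cubeVector n = c := by
  decide

/-- The linear endomorphism of the binary cube with given columns. -/
def cubeHom (x y z : ZMod 2 × ZMod 2 × ZMod 2) :
    ZMod 2 × ZMod 2 × ZMod 2 →+ ZMod 2 × ZMod 2 × ZMod 2 where
  toFun c := c.1 • x + c.2.1 • y + c.2.2 • z
  map_zero' := by simp
  map_add' c d := by simp only [Prod.fst_add, Prod.snd_add, add_smul]; abel

theorem cubeVector_affineBits (x y z t c : ℕ) : cubeVector (affineBits x y z t c) =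
    cubeHom (cubeVector x) (cubeVector y) (cubeVector z) (cubeVector c) + cubeVector t := by
  have h0 : cubeVector 0 = 0 := by decide
  have hb : ∀ (b : Bool) (n : ℕ), cubeVector (bif b then n else 0) =
      (bif b then (1 : ZMod 2) else 0) • cubeVector n := by
    intro b n
    cases b <;> simp [h0]
  rw [affineBits, cubeVector_xor, cubeVector_xor, cubeVector_xor, hb, hb, hb, cubeHom]
  simp only [AddMonoidHom.coe_mk, ZeroHom.coe_mk]
  simp only [cubeVector]
  abel

theorem affineBits_lt {x y z t : ℕ} (hx : x < 8) (hy : y < 8) (hz : z < 8) (ht : t < 8) (c : ℕ) :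
    affineBits x y z t c < 8 := by
  have hb : ∀ (b : Bool) (n : ℕ), n < 2 ^ 3 → (bif b then n else 0) < 2 ^ 3 := by
    intro b n hn
    cases b
    · simp
    · exact hn
  exact Nat.xor_lt_two_pow (Nat.xor_lt_two_pow (Nat.xor_lt_two_pow ht (hb _ _ hx)) (hb _ _ hy))
    (hb _ _ hz)

set_option synthInstance.maxHeartbeats 400000 in
set_option synthInstance.maxSize 1000 in
theorem cubeHom_injective_of_independentBits {x y z : ℕ} (hx : x < 8) (hy : y < 8) (hz : z < 8)
    (h : independentBits x y z = true) :
    Function.Injective (cubeHom (cubeVector x) (cubeVector y) (cubeVector z)) := by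
  have key : ∀ x < 8, ∀ y < 8, ∀ z < 8, independentBits x y z = true → ∀ c < 8, c ≠ 0 →
      affineBits x y z 0 c ≠ 0 := by
    decide +kernel
  have h0 : cubeVector 0 = 0 := by decide
  rw [injective_iff_map_eq_zero]
  intro c hc
  obtain ⟨n, hn, rfl⟩ := exists_cubeVector c
  by_contra hne
  have hn0 : n ≠ 0 := fun h => hne (h ▸ h0)
  refine key x hx y hy z hz h n hn hn0
    (cubeVector_injOn _ (affineBits_lt hx hy hz (by omega) n) _ (by omega) ?_)
  rw [cubeVector_affineBits, hc, h0, add_zero]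

/-- An affine permutation of an abelian group preserving or interchanging two sets; in the first
case it is not the identity. -/
def IsAffineSymmetry {M : Type*} [AddCommGroup M] (S T : Set M) (α : M ≃+ M) (b : M) : Prop :=
  ((∃ c, α c + b ≠ c) ∧ (∀ c, α c + b ∈ S ↔ c ∈ S) ∧ ∀ c, α c + b ∈ T ↔ c ∈ T) ∨
    ((∀ c, α c + b ∈ T ↔ c ∈ S) ∧ ∀ c, α c + b ∈ S ↔ c ∈ T)

/-- The new symmetry is the old one conjugated by the affine map c ↦ β c + d. -/
theorem IsAffineSymmetry.conj {M : Type*} [AddCommGroup M] {S T S' T' : Set M} {α : M ≃+ M}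
    {b : M} (h : IsAffineSymmetry S' T' α b) (β : M ≃+ M) (d : M)
    (hS : ∀ c, β c + d ∈ S' ↔ c ∈ S) (hT : ∀ c, β c + d ∈ T' ↔ c ∈ T) :
    IsAffineSymmetry S T (β.trans (α.trans β.symm)) (β.symm (α d + b - d)) := by
  have key : ∀ c, β ((β.trans (α.trans β.symm)) c + β.symm (α d + b - d)) + d =
      α (β c + d) + b := by
    intro c
    simp only [AddEquiv.trans_apply, map_add, AddEquiv.apply_symm_apply]
    abel
  rcases h with ⟨⟨c, hc⟩, h1, h2⟩ | ⟨h1, h2⟩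
  · refine Or.inl ⟨⟨β.symm (c - d), fun he => hc ?_⟩, fun c => ?_, fun c => ?_⟩
    · have := key (β.symm (c - d))
      rw [he] at this
      simpa using this.symm
    · rw [← hS, key, h1, hS]
    · rw [← hT, key, h2, hT]
  · refine Or.inr ⟨fun c => ?_, fun c => ?_⟩
    · rw [← hT, key, h1, hS]
    · rw [← hS, key, h2, hT]

theorem exists_cube_affine {Q : ℕ → ℕ → Bool} {ok : ℕ → ℕ → ℕ → ℕ → Bool}
    (h : existsAffine Q ok = true) :
    ∃ (α : (ZMod 2 × ZMod 2 × ZMod 2) ≃+ (ZMod 2 × ZMod 2 × ZMod 2)) (x y z t : ℕ),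
      ok x y z t = true ∧ x < 8 ∧ y < 8 ∧ z < 8 ∧ t < 8 ∧
      (∀ c, α (cubeVector c) + cubeVector t = cubeVector (affineBits x y z t c)) ∧
      ∀ c < 8, Q c (affineBits x y z t c) = true := by
  obtain ⟨x, hx, y, hy, z, hz, t, ht, hind, hok, hQ⟩ := existsAffine_sound h
  exact ⟨AddEquiv.ofBijective _ (Finite.injective_iff_bijective.1
    (cubeHom_injective_of_independentBits hx hy hz hind)), x, y, z, t, hok, hx, hy, hz, ht,
    fun c => (cubeVector_affineBits x y z t c).symm, hQ⟩

/-- The bit mask of a subset of the binary cube. -/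
def cubeMask (S : Finset (ZMod 2 × ZMod 2 × ZMod 2)) : ℕ :=
  Nat.ofBits fun i : Fin 8 => decide (cubeVector i ∈ S)

theorem testBit_cubeMask (S : Finset (ZMod 2 × ZMod 2 × ZMod 2)) {n : ℕ} (hn : n < 8) :
    (cubeMask S).testBit n = decide (cubeVector n ∈ S) :=
  Nat.testBit_ofBits_lt _ n hn

theorem cubeMask_lt (S : Finset (ZMod 2 × ZMod 2 × ZMod 2)) : cubeMask S < 256 :=
  Nat.ofBits_lt_two_pow _

theorem bitCount_cubeMask (S : Finset (ZMod 2 × ZMod 2 × ZMod 2)) :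
    bitCount 8 (cubeMask S) = S.card := by
  rw [bitCount_eq_card]
  refine Finset.card_bij (fun i _ => cubeVector i) ?_ ?_ ?_
  · intro i hi
    simpa [testBit_cubeMask S i.2] using hi
  · intro i _ j _ hij
    exact Fin.ext (cubeVector_injOn _ i.2 _ j.2 hij)
  · intro c hc
    obtain ⟨n, hn, rfl⟩ := exists_cubeVector c
    exact ⟨⟨n, hn⟩, by simpa [testBit_cubeMask S hn] using hc, rfl⟩

/-- An affine map carries `S` to a representative and `T` along with it; a symmetry found for the
image pair is conjugated back. -/
theorem exists_isAffineSymmetry_cube (S T : Finset (ZMod 2 × ZMod 2 × ZMod 2))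
    (hcard : S.card = T.card) :
    ∃ α b, IsAffineSymmetry (S : Set (ZMod 2 × ZMod 2 × ZMod 2)) T α b := by
  have h1 := existsAffine_to_cubeSubsets
  simp only [List.all_eq_true, List.any_eq_true, List.mem_range, Bool.and_eq_true,
    beq_iff_eq] at h1
  obtain ⟨r, hr, hcr, h1⟩ := h1 _ (cubeMask_lt S)
  obtain ⟨β, x, y, z, d, -, hx, hy, hz, hd, hβ, hQ⟩ := exists_cube_affine h1
  have hψ : Function.Injective fun c => β c + cubeVector d := fun a b hab =>
    β.injective (add_right_cancel hab)
  let S' := S.image fun c => β c + cubeVector d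
  let T' := T.image fun c => β c + cubeVector d
  have hS' : ∀ c, β c + cubeVector d ∈ S' ↔ c ∈ S := fun c => hψ.mem_finset_image
  have hT' : ∀ c, β c + cubeVector d ∈ T' ↔ c ∈ T := fun c => hψ.mem_finset_image
  have hrS : ∀ n < 8, r.testBit n = decide (cubeVector n ∈ S') := by
    intro n hn
    obtain ⟨c, hc⟩ := (Finite.injective_iff_bijective.1 hψ).2 (cubeVector n)
    obtain ⟨k, hk, rfl⟩ := exists_cubeVector c
    have hc' : cubeVector (affineBits x y z d k) = cubeVector n := (hβ k).symm.trans hc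
    have := hQ k hk
    rw [cubeVector_injOn _ (affineBits_lt hx hy hz hd k) _ hn hc', beq_iff_eq,
      testBit_cubeMask S hk] at this
    rw [this, ← hc]
    simp only [hS']
  have hct : bitCount 8 r = bitCount 8 (cubeMask T') := by
    rw [hcr, bitCount_cubeMask, bitCount_cubeMask, hcard, Finset.card_image_of_injective _ hψ]
  have h2 := existsAffine_of_cubeSubsets
  simp only [List.all_eq_true, List.mem_range, Bool.or_eq_true, bne_iff_ne] at h2
  suffices h : ∃ α b, IsAffineSymmetry (S' : Set (ZMod 2 × ZMod 2 × ZMod 2)) T' α b by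
    obtain ⟨α, b, h⟩ := h
    exact ⟨_, _, h.conj β (cubeVector d) hS' hT'⟩
  rcases h2 r hr _ (cubeMask_lt T') with (h2 | h2) | h2
  · exact absurd hct h2
  · obtain ⟨α, x, y, z, t, hok, hx, hy, hz, ht, hα, hQ⟩ := exists_cube_affine h2
    simp only [Bool.and_eq_true, beq_iff_eq] at hQ
    refine ⟨α, cubeVector t, Or.inl ⟨?_, fun c => ?_, fun c => ?_⟩⟩
    -- The values at 0, 1, 2 and 4 recover the constant term and the columns, so the identity is
    -- exactly what the `ok` test rejects.
    · by_contra! hid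
      have hbits : ∀ n < 8, affineBits x y z t n = n := fun n hn =>
        cubeVector_injOn _ (affineBits_lt hx hy hz ht n) _ hn ((hα n).symm.trans (hid _))
      have e0 := hbits 0 (by omega)
      have e1 := hbits 1 (by omega)
      have e2 := hbits 2 (by omega)
      have e4 := hbits 4 (by omega)
      simp [affineBits, Nat.testBit] at e0 e1 e2 e4
      subst e0
      simp at e1 e2 e4
      simp [e1, e2, e4] at hok
    · obtain ⟨n, hn, rfl⟩ := exists_cubeVector c
      have := (hQ n hn).1
      rw [hrS _ hn, hrS _ (affineBits_lt hx hy hz ht n), decide_eq_decide] at this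
      rwa [hα]
    · obtain ⟨n, hn, rfl⟩ := exists_cubeVector c
      have := (hQ n hn).2
      rw [testBit_cubeMask _ hn, testBit_cubeMask _ (affineBits_lt hx hy hz ht n),
        decide_eq_decide] at this
      rwa [hα]
  · obtain ⟨α, x, y, z, t, -, hx, hy, hz, ht, hα, hQ⟩ := exists_cube_affine h2
    simp only [Bool.and_eq_true, beq_iff_eq] at hQ
    refine ⟨α, cubeVector t, Or.inr ⟨fun c => ?_, fun c => ?_⟩⟩
    · obtain ⟨n, hn, rfl⟩ := exists_cubeVector c
      have := (hQ n hn).1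
      rw [hrS _ hn, testBit_cubeMask _ (affineBits_lt hx hy hz ht n), decide_eq_decide] at this
      rwa [hα]
    · obtain ⟨n, hn, rfl⟩ := exists_cubeVector c
      have := (hQ n hn).2
      rw [hrS _ (affineBits_lt hx hy hz ht n), testBit_cubeMask _ hn, decide_eq_decide] at this
      rwa [hα]

/-- In characteristic two the opposite translations by b and -b coincide, so an ordinary affine
symmetry is enough. -/
theorem hasAffineSymmetries_zmod_two_cube :
    HasAffineSymmetries (Multiplicative (ZMod 2 × ZMod 2 × ZMod 2)) := by
  refine hasAffineSymmetries_multiplicative fun S T hST => ?_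
  have hsub : ∀ c d : ZMod 2 × ZMod 2 × ZMod 2, c - d = c + d := by decide
  obtain ⟨α, b, ⟨⟨c, hc⟩, h1, h2⟩ | ⟨h1, h2⟩⟩ := exists_isAffineSymmetry_cube S T hST
  · refine ⟨α, b, Or.inl ⟨?_, h1, fun c => by rw [hsub]; exact h2 c⟩⟩
    by_contra! hid
    exact hc (by rw [hid.1, hid.2, add_zero])
  · exact ⟨α, b, Or.inr ⟨h1, fun c => by rw [hsub]; exact h2 c⟩⟩

/-! ### The classification -/

theorem theorem1p1 (G : Type u) [Group G] [Finite G] (n : ℕ) (hn : 0 < n) :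
    ¬ AdmitsPartiteRepresentation.{u, v} G n ↔
      (n = 1 ∧ 3 ≤ Nat.card G) ∨
      (n = 2 ∧
        (Nonempty (G ≃* Multiplicative (ZMod 1)) ∨
         Nonempty (G ≃* Multiplicative (ZMod 2)) ∨
         Nonempty (G ≃* Multiplicative (ZMod 3)) ∨
         Nonempty (G ≃* Multiplicative (ZMod 2 × ZMod 2)) ∨
         Nonempty (G ≃* Multiplicative (ZMod 2 × ZMod 2 × ZMod 2)))) ∨
      ((3 ≤ n ∧ n ≤ 5) ∧ Nonempty (G ≃* Multiplicative (ZMod 1))) := by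
  have hsub : Nonempty (G ≃* Multiplicative (ZMod 1)) → Subsingleton G := by
    rintro ⟨e⟩
    have : Subsingleton (Multiplicative (ZMod 1)) := inferInstanceAs (Subsingleton (Fin 1))
    exact e.toEquiv.subsingleton
  constructor
  · intro h
    obtain rfl | rfl | hn3 : n = 1 ∨ n = 2 ∨ 3 ≤ n := by omega
    · left
      refine ⟨rfl, ?_⟩
      by_contra! hG
      exact h (admits_one_of_card_le_two (by omega))
    · right; left
      exact ⟨rfl, (admits_two_or_exceptional.{u, v} G).resolve_left h⟩
    · right; right
      rcases subsingleton_or_nontrivial G with hG | hG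
      · refine ⟨⟨hn3, ?_⟩, mulEquiv_zmod_one Nat.card_unique⟩
        by_contra! hn6
        exact h (admits_of_six_le hn6)
      · exact absurd (admits_of_three_le hn3) h
  · rintro (⟨rfl, hG⟩ | ⟨rfl, hG | ⟨⟨e⟩⟩ | ⟨⟨e⟩⟩ | ⟨⟨e⟩⟩ | ⟨⟨e⟩⟩⟩ | ⟨⟨hn3, hn5⟩, hG⟩)
    · exact not_admits_one hG
    · have := hsub hG
      exact not_admits_of_subsingleton le_rfl (by omega)
    · exact hasAffineSymmetries_zmod_two.not_admits_two e
    · exact hasAffineSymmetries_zmod_three.not_admits_two e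
    · exact hasAffineSymmetries_zmod_two_sq.not_admits_two e
    · exact hasAffineSymmetries_zmod_two_cube.not_admits_two e
    · have := hsub hG
      exact not_admits_of_subsingleton (by omega) hn5
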